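/- **Theorem 2.1.** Let $n\ge 3$ be an odd integer, let $T>0$, $\mathcal M=(0,T)\times\mathbb R^n$, $\mathcal S=\{0\}\times\mathbb R^n$ (identified with $\mathbb R^n$), $\mathcal C=\mathbb R^n\times\mathbb S^{n-1}$ with the standard product measure, and let $\mathscr V\subset\mathcal S$ be compact. Let $s\ge 0$, let $(f_1,f_2)\in H^{s+1}(\mathcal S)\times H^s(\mathcal S)$ be supported in $\mathscr V$, and let $u$ be the solution of the Cauchy problem $$\square u=0 \ \text{ on } \mathcal M,\qquad u=f_1,\quad \partial_t u=f_2 \ \text{ on } \mathcal S,\qquad \square=-\partial_t^2+\Delta_x .$$ Here the solution is understood as a complex-valued $u\in L^2(\mathcal M)$ with $$\int_{\mathcal M}u\,\square\varphi\,dt\,dx=\int_{\mathbb R^n}f_1(x)\,\partial_t\varphi(0,x)\,dx-\int_{\mathbb R^n}f_2(x)\,\varphi(0,x)\,dx \quad\text{for all }\varphi\in C_c^\infty((-\infty,T)\times\mathbb R^n).$$ Let $$Lu(y,\theta)=\int_0^{T}u(r,y+r\theta)\,dr,\qquad (y,\theta)\in\mathcal C,$$ be the light ray transform of $u$ (extended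 by $0$ outside $\mathcal M$). Then: 1. $Lu$ uniquely determines $u$ on $\mathcal M$ and $f_1,f_2$ on $\mathcal S$: if $v$ is the solution with Cauchy data $(g_1,g_2)\in H^{s+1}(\mathcal S)\times H^s(\mathcal S)$ supported in $\mathscr V$ and $Lu=Lv$ a.e. on $\mathcal C$, then $u=v$ a.e. on $\mathcal M$ and $f_1=g_1$, $f_2=g_2$ a.e. on $\mathcal S$. 2. There is a constant $C>0$, depending only on $n$, $T$ and $\mathscr V$, such that for all such $s$, $f_1$, $f_2$, $u$ $$\|f_1\|_{H^{s+1}(\mathcal S)}+\|f_2\|_{H^{s}(\mathcal S)}\le C\,\|Lu\|_{H^{s+n/2}(\mathcal C)} .$$ Here $\|f\|_{H^k(\mathcal S)}=\|(1-\Delta)^{k/2}f\|_{L^2(\mathbb R^n)}$ and $\|F\|_{H^k(\mathcal C)}=\|(1-\Delta_y-\Delta_\theta)^{k/2}F\|_{L^2(\mathcal C)}$, where $\Delta_\theta$ is the Laplace–Beltrami operator of $\mathbb S^{n-1}$; a norm is $+\infty$ if the function is not in the space. -/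

import Mathlib

open MeasureTheory Set
open scoped ContDiff ENNReal FourierTransform Laplacian

noncomputable section

namespace LightRay

/-- Euclidean space `ℝⁿ`. -/
abbrev E (n : ℕ) : Type := EuclideanSpace ℝ (Fin n)

/-- The unit sphere `𝕊ⁿ⁻¹` in `ℝⁿ`. -/
abbrev S (n : ℕ) : Type := Metric.sphere (0 : E n) 1

/-- The usual surface measure on `𝕊ⁿ⁻¹`. -/
abbrev sphereMeasure (n : ℕ) : Measure (S n) := (volume : Measure (E n)).toSphere

/-- The standard product measure on `𝒞 = ℝⁿ × 𝕊ⁿ⁻¹`. -/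
abbrev cylMeasure (n : ℕ) : Measure (E n × S n) := (volume : Measure (E n)).prod (sphereMeasure n)

/-! ### Sobolev norms -/

/-- The Fourier–Plancherel transform of `f ∈ L²(ℝⁿ)`, in Mathlib's normalization
`f̂(ξ) = ∫ exp(-2πi x·ξ) f(x) dx` (and `0` if `f ∉ L²`). -/
def l2Fourier {n : ℕ} (f : E n → ℂ) : E n → ℂ :=
  open Classical in
  if h : MemLp f 2 (volume : Measure (E n)) then
    ((𝓕 (h.toLp f) : Lp ℂ 2 (volume : Measure (E n))) : E n → ℂ)
  else 0

/-- The norm of `H^k(ℝⁿ)`, `k ≥ 0`, that is `‖(1 - Δ)^{k/2} f‖_{L²}`; it is `∞` if `f ∉ H^k`.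
In Mathlib's normalization of the Fourier transform, `-Δ` has the symbol `(2π‖ξ‖)²`. -/
def sobolevENorm {n : ℕ} (k : ℝ) (f : E n → ℂ) : ℝ≥0∞ :=
  open Classical in
  if MemLp f 2 (volume : Measure (E n)) then
    (∫⁻ ξ, ENNReal.ofReal ((1 + (2 * Real.pi * ‖ξ‖) ^ 2) ^ k) * ‖l2Fourier f ξ‖ₑ ^ 2)
      ^ (1 / 2 : ℝ)
  else ⊤

/-- The monomial `θ ↦ θ^α` restricted to the sphere, as an element of `L²(𝕊ⁿ⁻¹)`. -/
def sphereMonomial {n : ℕ} (α : Fin n → ℕ) : Lp ℂ 2 (sphereMeasure n) :=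
  ContinuousMap.toLp 2 (sphereMeasure n) ℂ
    ⟨fun θ : S n => ∏ i, (((θ : E n) i : ℝ) : ℂ) ^ α i, by fun_prop⟩

/-- Restrictions to the sphere of complex polynomials of degree `< d`. -/
def spherePoly (n d : ℕ) : Submodule ℂ (Lp ℂ 2 (sphereMeasure n)) :=
  Submodule.span ℂ (sphereMonomial '' {α : Fin n → ℕ | ∑ i, α i < d})

/-- Spherical harmonics of degree `ℓ`: restrictions to the sphere of polynomials of degree `≤ ℓ`,
orthogonal in `L²(𝕊ⁿ⁻¹)` to all those of degree `< ℓ`. This is the eigenspace of the (nonnegative)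
Laplace–Beltrami operator `-Δ_θ` of `𝕊ⁿ⁻¹` with eigenvalue `ℓ(ℓ + n - 2)`. -/
def sphericalHarmonics (n ℓ : ℕ) : Submodule ℂ (Lp ℂ 2 (sphereMeasure n)) :=
  spherePoly n (ℓ + 1) ⊓ (spherePoly n ℓ)ᗮ

instance spherePoly_finiteDimensional (n d : ℕ) : FiniteDimensional ℂ (spherePoly n d) := by
  refine FiniteDimensional.span_of_finite ℂ (Set.Finite.image _ ?_)
  refine (Set.finite_Iic (fun _ : Fin n => d)).subset fun α hα i => ?_
  exact ((Finset.single_le_sum (f := α) (fun _ _ => Nat.zero_le _) (Finset.mem_univ i)).trans_lt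
    hα).le

instance sphericalHarmonics_finiteDimensional (n ℓ : ℕ) :
    FiniteDimensional ℂ (sphericalHarmonics n ℓ) :=
  Submodule.finiteDimensional_of_le (inf_le_left : sphericalHarmonics n ℓ ≤ spherePoly n (ℓ + 1))

/-- The coefficient `y ↦ ⟨F(y, ·), Y⟩_{L²(𝕊ⁿ⁻¹)} = ∫ F(y, θ) conj(Y(θ)) dθ`. -/
def sphereCoeff {n : ℕ} (F : E n × S n → ℂ) (Y : Lp ℂ 2 (sphereMeasure n)) : E n → ℂ :=
  fun y => ∫ θ, F (y, θ) * (starRingEnd ℂ) (Y θ) ∂(sphereMeasure n)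

/-- The norm of `H^k(𝒞)`, `𝒞 = ℝⁿ × 𝕊ⁿ⁻¹`, `k ≥ 0`, that is
`‖(1 - Δ_y - Δ_θ)^{k/2} F‖_{L²(𝒞)}`, computed by the Fourier transform in `y` and the expansion in
(an orthonormal basis of) spherical harmonics in `θ`; it is `∞` if `F ∉ H^k(𝒞)`. -/
def cylSobolevENorm {n : ℕ} (k : ℝ) (F : E n × S n → ℂ) : ℝ≥0∞ :=
  open Classical in
  if MemLp F 2 (cylMeasure n) then
    (∑' ℓ : ℕ, ∑ j : Fin (Module.finrank ℂ (sphericalHarmonics n ℓ)),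
      ∫⁻ ξ, ENNReal.ofReal
          ((1 + (2 * Real.pi * ‖ξ‖) ^ 2 + (ℓ : ℝ) * ((ℓ : ℝ) + (n : ℝ) - 2)) ^ k) *
        ‖l2Fourier
          (sphereCoeff F (stdOrthonormalBasis ℂ (sphericalHarmonics n ℓ) j)) ξ‖ₑ ^ 2)
      ^ (1 / 2 : ℝ)
  else ⊤

/-! ### The wave equation and the light ray transform -/

/-- The spacetime slab `ℳ = (0, T) × ℝⁿ`. -/
def slab (n : ℕ) (T : ℝ) : Set (ℝ × E n) := Ioo 0 T ×ˢ univ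

/-- The d'Alembertian `□ = -∂_t² + Δ_x`. -/
def box {n : ℕ} (φ : ℝ × E n → ℂ) (z : ℝ × E n) : ℂ :=
  -(iteratedDeriv 2 (fun τ => φ (τ, z.2)) z.1) + Δ (fun x => φ (z.1, x)) z.2

/-- `u ∈ L²(ℳ)` is a weak solution of the Cauchy problem `□u = 0` on `ℳ = (0, T) × ℝⁿ`, `u = f₁`
and `∂_t u = f₂` on `{0} × ℝⁿ`: for all test functions `φ ∈ C_c^∞((-∞, T) × ℝⁿ)`,
`∫_ℳ u □φ dt dx = ∫ f₁(x) ∂_tφ(0, x) dx - ∫ f₂(x) φ(0, x) dx`,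
which is what `□u = 0` becomes after two integrations by parts. -/
structure IsCauchySolution {n : ℕ} (T : ℝ) (f₁ f₂ : E n → ℂ) (u : ℝ × E n → ℂ) : Prop where
  memLp : MemLp u 2 (volume.restrict (slab n T))
  weak : ∀ φ : ℝ × E n → ℂ, ContDiff ℝ ∞ φ → HasCompactSupport φ →
    tsupport φ ⊆ Iio T ×ˢ univ →
    ∫ z in slab n T, u z * box φ z =
      (∫ x, f₁ x * deriv (fun τ => φ (τ, x)) 0) - ∫ x, f₂ x * φ (0, x)

/-- Cauchy data `(f₁, f₂) ∈ H^{s+1}(ℝⁿ) × H^s(ℝⁿ)` supported in `V`. -/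
structure IsCauchyData {n : ℕ} (s : ℝ) (V : Set (E n)) (f₁ f₂ : E n → ℂ) : Prop where
  sobolev₁ : sobolevENorm (s + 1) f₁ < ⊤
  sobolev₂ : sobolevENorm s f₂ < ⊤
  supp₁ : ∀ᵐ x, x ∉ V → f₁ x = 0
  supp₂ : ∀ᵐ x, x ∉ V → f₂ x = 0

/-- The light ray transform `Lf(y, θ) = ∫ f(r, y + rθ) dr`. -/
def lightRay {n : ℕ} (f : ℝ × E n → ℂ) : E n × S n → ℂ :=
  fun p => ∫ r : ℝ, f (r, p.1 + r • (p.2 : E n))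

/-- The light ray transform of a function on `ℳ = (0, T) × ℝⁿ` (extended by zero). -/
def lightRaySlab {n : ℕ} (T : ℝ) (u : ℝ × E n → ℂ) : E n × S n → ℂ :=
  lightRay ((slab n T).indicator u)

end LightRay

end

open scoped SchwartzMap Pointwise
namespace LightRay

/-! ### The Plancherel transform and separating families of test functions -/

section

variable {n : ℕ}

/-! Everything happens on the Fourier side in the space variable. Write `l = 2π‖ξ‖`. A weak solution
has, for almost every `t`, the spatial transform `f̂₁ cos(lt) + f̂₂ sin(lt)/l`
(`IsCauchySolution.isSpectralSolution`). This is a uniqueness statement for an oscillator in a weak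
sense: paired with band-limited functions, the difference between the solution and this formula
gives functions of time with `d_k'' = -d_{k+1}`, zero Cauchy data and at most geometric growth in
`k`. Moving `2k` derivatives onto the test function produces a factorial that forces `d_0 = 0`
(`ae_eq_zero_of_weak_recursion`).

Translation by `rθ` becomes a phase, so the transform in `y` of `Lu` at `(ξ, θ)` is the integral
over `0 < r < T` of `(A e^{ilr} + B e^{-ilr}) e^{ilrc}`, where `c` is the cosine of the angle
between `ξ` and `θ` and `A`, `B` are the amplitudes of the two exponentials
(`IsSpectralSolution.l2Fourier_sphereCoeff`). At `c = ±1` one exponential is cancelled and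
contributes its amplitude times `T`, while the other oscillates and contributes at most `T - δ`
times its amplitude once `l ≥ ε`. The two values together therefore control `δ(|A| + |B|)`
(`le_norm_rayIntegral_add`). The integral is Lipschitz in `c` with constant of order `l`, and `c`
varies quadratically near the poles, so the lower bound survives on a cap of radius of order
`l^{-1/2}` and area of order `l^{-(n-1)/2}`. The resulting loss fits into the `n/2` derivatives
allowed precisely because `n ≥ 3` (`exists_le_lintegral_rayIntegral`).

Frequencies below `ε` are not recovered directly. The transform of a function supported in a compact
set is bounded by a multiple of its `L²` norm, so a small ball of frequencies holds at most half of
the mass and is dominated by the rest (`exists_lintegral_l2Fourier_le`). Parseval in spherical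
harmonics (`tsum_sphericalHarmonics`) turns the norm on the cylinder into an average over
directions. Together these give the estimate `exists_sobolevENorm_le`, and uniqueness is that
estimate applied to a difference of solutions. -/

theorem l2Fourier_of_memLp {f : E n → ℂ} (hf : MemLp f 2 volume) :
    l2Fourier f = ((𝓕 (hf.toLp f) : Lp ℂ 2 (volume : Measure (E n))) : E n → ℂ) := by
  simp [l2Fourier, hf]

theorem memLp_l2Fourier (f : E n → ℂ) : MemLp (l2Fourier f) 2 volume := by
  unfold l2Fourier
  split_ifs with h
  · exact Lp.memLp _
  · exact MemLp.zero

theorem eLpNorm_l2Fourier {f : E n → ℂ} (hf : MemLp f 2 volume) :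
    eLpNorm (l2Fourier f) 2 volume = eLpNorm f 2 volume := by
  rw [l2Fourier_of_memLp hf, ← Lp.enorm_def, ← ofReal_norm, Lp.norm_fourier_eq,
    ofReal_norm, Lp.enorm_toLp]

theorem l2Fourier_ae_eq_zero {f : E n → ℂ} (hf : MemLp f 2 volume)
    (h : l2Fourier f =ᵐ[volume] 0) : f =ᵐ[volume] 0 := by
  rw [← eLpNorm_eq_zero_iff hf.1 two_ne_zero, ← eLpNorm_l2Fourier hf]
  exact (eLpNorm_eq_zero_iff (memLp_l2Fourier f).1 (by norm_num)).2 h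

theorem l2Fourier_sub {f g : E n → ℂ} (hf : MemLp f 2 volume) (hg : MemLp g 2 volume) :
    l2Fourier (f - g) =ᵐ[volume] l2Fourier f - l2Fourier g := by
  rw [l2Fourier_of_memLp hf, l2Fourier_of_memLp hg, l2Fourier_of_memLp (hf.sub hg),
    MemLp.toLp_sub hf hg]
  have : 𝓕 (hf.toLp f - hg.toLp g) = 𝓕 (hf.toLp f) - 𝓕 (hg.toLp g) :=
    (Lp.fourierTransformₗᵢ (E n) ℂ).map_sub _ _
  rw [this]
  exact Lp.coeFn_sub _ _

/-- Compatibility of the `L²` transform with the transform of tempered distributions. The transforms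
of slices and of ray data are identified through this duality, without pointwise formulas. -/
theorem integral_l2Fourier_mul {f : E n → ℂ} (hf : MemLp f 2 volume) (h : 𝓢(E n, ℂ)) :
    ∫ ξ, l2Fourier f ξ * h ξ = ∫ x, f x * 𝓕 h x := by
  have key := congrArg (fun T : 𝓢'(E n, ℂ) => T h)
    (Lp.fourier_toTemperedDistribution_eq (hf.toLp f))
  simp only [TemperedDistribution.fourier_apply, Lp.toTemperedDistribution_apply] at key
  rw [l2Fourier_of_memLp hf]
  calc _ = ∫ x, h x • (𝓕 (hf.toLp f) : Lp ℂ 2 (volume : Measure (E n))) x := by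
        simp only [smul_eq_mul, mul_comm]
    _ = _ := key.symm
    _ = _ := by
        refine integral_congr_ae ?_
        filter_upwards [hf.coeFn_toLp] with x hx
        rw [hx, smul_eq_mul, mul_comm]

/-- Square-integrable functions with the same pairings against smooth compactly supported functions
agree almost everywhere. -/
theorem ae_eq_of_integral_mul_schwartz {F G : E n → ℂ} (hF : MemLp F 2 volume)
    (hG : MemLp G 2 volume)
    (h : ∀ φ : 𝓢(E n, ℂ), HasCompactSupport φ → ∫ ξ, F ξ * φ ξ = ∫ ξ, G ξ * φ ξ) :
    F =ᵐ[volume] G := by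
  refine ae_eq_of_integral_contDiff_smul_eq (hF.locallyIntegrable (by norm_num))
    (hG.locallyIntegrable (by norm_num)) fun g hg hc => ?_
  have hc' : HasCompactSupport (Complex.ofRealCLM ∘ g) := hc.comp_left rfl
  have hg' : ContDiff ℝ ∞ (Complex.ofRealCLM ∘ g) := by fun_prop
  simpa [Complex.real_smul, mul_comm] using h (hc'.toSchwartzMap hg') hc'

theorem integrable_mul_schwartz {F : E n → ℂ} (hF : MemLp F 2 volume) (φ : 𝓢(E n, ℂ)) :
    Integrable (fun ξ => F ξ * φ ξ) volume :=
  MemLp.integrable_mul hF (φ.memLp 2 volume)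

/-- A countable family of smooth compactly supported functions that separates points of `L²`. -/
theorem exists_countable_separating (n : ℕ) :
    ∃ H : ℕ → 𝓢(E n, ℂ), (∀ i, HasCompactSupport (H i)) ∧
      ∀ F G : E n → ℂ, MemLp F 2 volume → MemLp G 2 volume →
        (∀ i, ∫ ξ, F ξ * H i ξ = ∫ ξ, G ξ * H i ξ) → F =ᵐ[volume] G := by
  let D : Set (Lp ℂ 2 (volume : Measure (E n))) :=
    (fun h : 𝓢(E n, ℂ) => h.toLp 2 volume) '' {h | HasCompactSupport h}
  have hD : Dense D := by
    intro f
    refine (mem_closure_iff_nhds_basis Metric.nhds_basis_closedBall).2 fun ε hε => ?_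
    obtain ⟨g, hg₁, hg₂, hg₃⟩ :=
      MemLp.exist_eLpNorm_sub_le (by norm_num) (by norm_num) (Lp.memLp f) hε
    refine ⟨_, ⟨hg₁.toSchwartzMap hg₂, hg₁, rfl⟩, ?_⟩
    have : (f : E n → ℂ) - ((hg₁.toSchwartzMap hg₂).toLp 2 volume : E n → ℂ)
        =ᵐ[volume] (f : E n → ℂ) - g := by
      filter_upwards [(hg₁.toSchwartzMap hg₂).coeFn_toLp 2 volume]
      simp
    simp only [Metric.mem_closedBall', Lp.dist_def, eLpNorm_congr_ae this]
    grw [hg₃, ENNReal.toReal_ofReal hε.le]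
    simp
  have : Fact ((2 : ℝ≥0∞) ≠ ⊤) := ⟨by norm_num⟩
  have : TopologicalSpace.SeparableSpace D := inferInstance
  obtain ⟨C, hCD, hCc, hCd⟩ := hD.exists_countable_dense_subset
  have hne : C.Nonempty := hCd.nonempty
  obtain ⟨s, hs⟩ := hCc.exists_eq_range hne
  have hsD : ∀ i, ∃ h : 𝓢(E n, ℂ), HasCompactSupport h ∧ h.toLp 2 volume = s i := fun i => by
    obtain ⟨h, hh, e⟩ := hCD (hs ▸ mem_range_self i)
    exact ⟨h, hh, e⟩
  choose h hc he using hsD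
  -- The inner product conjugates its first argument, whereas the pairings in the statement are
  -- bilinear; hence the conjugates.
  have hcs : ∀ i, HasCompactSupport (Complex.conjCLE ∘ h i) := fun i => (hc i).comp_left (by simp)
  have hsm : ∀ i, ContDiff ℝ ∞ (Complex.conjCLE ∘ h i) := fun i =>
    Complex.conjCLE.contDiff.comp ((h i).smooth ⊤)
  refine ⟨fun i => (hcs i).toSchwartzMap (hsm i), fun i => hcs i, fun F G hF hG hFG => ?_⟩
  rw [← MemLp.toLp_eq_toLp_iff hF hG, ← sub_eq_zero]
  refine hCd.eq_zero_of_inner_right (𝕜 := ℂ) fun v hv => ?_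
  obtain ⟨i, rfl⟩ : ∃ i, s i = v := by rw [hs] at hv; exact hv
  rw [inner_sub_right, sub_eq_zero, ← he i]
  have aux : ∀ K : E n → ℂ, (hK : MemLp K 2 volume) →
      inner ℂ ((h i).toLp 2 volume) (hK.toLp K) = ∫ ξ, K ξ * (starRingEnd ℂ) (h i ξ) := by
    intro K hK
    rw [L2.inner_def]
    refine integral_congr_ae ?_
    filter_upwards [hK.coeFn_toLp, (h i).coeFn_toLp 2 volume] with x h1 h2
    rw [h1, h2]
    simp
  rw [aux F hF, aux G hG]
  exact hFG i

end

/-! ### Uniqueness for a weak second-order recursion in time -/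

section

/-- The `m`-fold antiderivative of `ψ` based at `T`. -/
noncomputable def iteratedPrimitive (T : ℝ) (ψ : ℝ → ℝ) : ℕ → ℝ → ℝ
  | 0 => ψ
  | m + 1 => fun t => ∫ s in T..t, iteratedPrimitive T ψ m s

section iteratedPrimitive

variable {T : ℝ} {ψ : ℝ → ℝ}

theorem deriv_iteratedPrimitive_succ {m : ℕ} (h : Continuous (iteratedPrimitive T ψ m)) :
    deriv (iteratedPrimitive T ψ (m + 1)) = iteratedPrimitive T ψ m := by
  funext t
  exact h.deriv_integral _ T t

theorem contDiff_iteratedPrimitive (hψ : ContDiff ℝ ∞ ψ) (m : ℕ) :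
    ContDiff ℝ ∞ (iteratedPrimitive T ψ m) := by
  induction m with
  | zero => exact hψ
  | succ m ih =>
    rw [contDiff_infty_iff_deriv, deriv_iteratedPrimitive_succ ih.continuous]
    refine ⟨fun t => ?_, ih⟩
    exact (intervalIntegral.integral_hasDerivAt_right (ih.continuous.intervalIntegrable _ _)
      (ih.continuous.stronglyMeasurableAtFilter _ _) ih.continuous.continuousAt).differentiableAt

theorem iteratedPrimitive_eq_zero {b : ℝ} (hb : b < T) (h : ∀ t, b ≤ t → ψ t = 0) (m : ℕ) :
    ∀ t, b ≤ t → iteratedPrimitive T ψ m t = 0 := by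
  induction m with
  | zero => exact h
  | succ m ih =>
    intro t ht
    refine intervalIntegral.integral_zero_ae (.of_forall fun s hs => ih s ?_)
    exact (lt_of_le_of_lt (le_min hb.le ht) hs.1).le

/-- Each integration from `T` raises the power of `T - t` and divides by the new exponent. The
factorial is what later beats geometric growth. -/
theorem abs_iteratedPrimitive_le {C : ℝ} (hψ : ContDiff ℝ ∞ ψ) (hC : ∀ t, |ψ t| ≤ C) (m : ℕ) :
    ∀ t ≤ T, |iteratedPrimitive T ψ m t| ≤ C * (T - t) ^ m / m.factorial := by
  induction m with
  | zero => intro t _; simpa [iteratedPrimitive] using hC t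
  | succ m ih =>
    intro t ht
    have h1 : |∫ s in t..T, iteratedPrimitive T ψ m s|
        ≤ ∫ s in t..T, C * (T - s) ^ m / m.factorial := by
      refine (intervalIntegral.abs_integral_le_integral_abs ht).trans ?_
      refine intervalIntegral.integral_mono_on ht
        ((contDiff_iteratedPrimitive hψ m).continuous.abs.intervalIntegrable _ _)
        (Continuous.intervalIntegrable (by fun_prop) _ _) fun s hs => ih s hs.2
    have h2 : ∫ s in t..T, C * (T - s) ^ m / m.factorial
        = C * (T - t) ^ (m + 1) / (m + 1).factorial := by
      have : ∫ s in t..T, (T - s) ^ m = (T - t) ^ (m + 1) / (m + 1) := by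
        rw [intervalIntegral.integral_comp_sub_left (fun s => s ^ m) T]
        simp
      rw [intervalIntegral.integral_div, intervalIntegral.integral_const_mul, this,
        Nat.factorial_succ]
      push_cast
      field_simp
    rw [h2] at h1
    simp only [iteratedPrimitive]
    rwa [intervalIntegral.integral_symm, abs_neg]

end iteratedPrimitive

/-- A test function on `(-∞, T)` may be cut off far to the left without changing it on `[0, T]`. -/
theorem exists_cutoff_left {T b : ℝ} (hb : b < T) {χ : ℝ → ℝ} (hχ : ContDiff ℝ ∞ χ)
    (h0 : ∀ t, b ≤ t → χ t = 0) :
    ∃ χ' : ℝ → ℝ, ContDiff ℝ ∞ χ' ∧ HasCompactSupport χ' ∧ tsupport χ' ⊆ Iio T ∧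
      ∀ t, -1 < t → χ' t = χ t := by
  refine ⟨fun t => Real.smoothTransition (t + 2) * χ t, ?_, ?_, ?_, ?_⟩
  · exact (Real.smoothTransition.contDiff.comp (contDiff_id.add contDiff_const)).mul hχ
  · refine HasCompactSupport.intro (isCompact_Icc (a := -2) (b := b)) fun t ht => ?_
    rcases lt_or_ge t (-2) with h | h
    · simp [Real.smoothTransition.zero_of_nonpos (x := t + 2) (by linarith)]
    · have : b ≤ t := by
        by_contra hlt
        exact ht ⟨h, by linarith⟩
      simp [h0 t this]
  · have : tsupport (fun t => Real.smoothTransition (t + 2) * χ t) ⊆ Iic b := by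
      refine closure_minimal (fun t ht => ?_) isClosed_Iic
      by_contra hlt
      simp only [mem_Iic, not_le] at hlt
      exact ht (by simp [h0 t hlt.le])
    exact this.trans fun t ht => lt_of_le_of_lt ht hb
  · intro t ht
    simp [Real.smoothTransition.one_of_one_le (x := t + 2) (by linarith)]

/-- If `d_k'' = - d_{k+1}` weakly on `(0, T)`, with vanishing Cauchy data at `0`, and `d_k` grows at
most geometrically, then `d_0 = 0`. -/
theorem ae_eq_zero_of_weak_recursion {T Λ M : ℝ} (hM : 0 ≤ M)
    (hΛ : 0 ≤ Λ) (d : ℕ → ℝ → ℂ) (hint : ∀ k, IntegrableOn (d k) (Ioo 0 T))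
    (hbound : ∀ k, ∫ t in Ioo 0 T, ‖d k t‖ ≤ M * Λ ^ k)
    (h : ∀ k (χ : ℝ → ℝ), ContDiff ℝ ∞ χ → HasCompactSupport χ → tsupport χ ⊆ Iio T →
      ∫ t in Ioo 0 T, (((deriv (deriv χ) t : ℝ) : ℂ) * d k t + (χ t : ℂ) * d (k + 1) t) = 0) :
    ∀ᵐ t, t ∈ Ioo 0 T → d 0 t = 0 := by
  refine isOpen_Ioo.ae_eq_zero_of_integral_contDiff_smul_eq_zero
    (hint 0).locallyIntegrableOn fun ψ hψ hψc hψs => ?_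
  obtain ⟨C, hC⟩ : ∃ C, ∀ t, |ψ t| ≤ C := by
    obtain ⟨C, hC⟩ := hψc.exists_bound_of_continuous hψ.continuous
    exact ⟨C, hC⟩
  have hC0 : 0 ≤ C := (abs_nonneg _).trans (hC 0)
  -- Beyond `b`, the function `ψ` and all its primitives based at `T` vanish, so these primitives
  -- are admissible near `t = T`.
  obtain ⟨b, hbT, hb⟩ : ∃ b < T, ∀ t, b ≤ t → ψ t = 0 := by
    rcases (tsupport ψ).eq_empty_or_nonempty with he | hne
    · refine ⟨T - 1, by linarith, fun t _ => ?_⟩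
      exact image_eq_zero_of_notMem_tsupport (by simp [he])
    · obtain ⟨m, hm, hmax⟩ := hψc.isCompact.exists_isMaxOn hne continuousOn_id
      have hmT := (hψs hm).2
      refine ⟨(m + T) / 2, by linarith, fun t ht => image_eq_zero_of_notMem_tsupport fun hts => ?_⟩
      have := hmax hts
      simp only [id] at this
      change t ≤ m at this
      linarith
  set J := iteratedPrimitive T ψ with hJ
  have hJc : ∀ m, ContDiff ℝ ∞ (J m) := contDiff_iteratedPrimitive hψ
  have hJb : ∀ m t, t ∈ Ioo 0 T → |J m t| ≤ C * T ^ m / m.factorial := by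
    intro m t ht
    refine (abs_iteratedPrimitive_le hψ hC m t ht.2.le).trans ?_
    gcongr
    · linarith [ht.2]
    · linarith [ht.1]
  have hJint : ∀ m k, IntegrableOn (fun t => (J m t : ℂ) * d k t) (Ioo 0 T) := by
    intro m k
    refine (hint k).bdd_mul (c := C * T ^ m / m.factorial) ?_ ?_
    · exact (Complex.continuous_ofReal.comp (hJc m).continuous).aestronglyMeasurable
    · refine (ae_restrict_iff' measurableSet_Ioo).2 (.of_forall fun t ht => ?_)
      simpa using hJb m t ht
  -- On `(0, T)` the primitive of order `2(k+1)` has the primitive of order `2k` as second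
  -- derivative; as a test function it trades `d k` for `d (k + 1)` at the cost of a sign.
  have step : ∀ k, ∫ t in Ioo 0 T, (J (2 * k) t : ℂ) * d k t
      = -∫ t in Ioo 0 T, (J (2 * (k + 1)) t : ℂ) * d (k + 1) t := by
    intro k
    obtain ⟨χ, h1, h2, h3, h4⟩ := exists_cutoff_left hbT (hJc (2 * (k + 1)))
      (iteratedPrimitive_eq_zero hbT hb _)
    have h5 := h k χ h1 h2 h3
    have hdd : ∀ t ∈ Ioo 0 T, deriv (deriv χ) t = J (2 * k) t := by
      intro t ht
      have e0 : χ =ᶠ[nhds t] J (2 * k + 1 + 1) := by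
        filter_upwards [Ioi_mem_nhds (show -1 < t by linarith [ht.1])] with s hs
        exact h4 s hs
      rw [e0.deriv.deriv_eq, hJ, deriv_iteratedPrimitive_succ (hJc _).continuous,
        deriv_iteratedPrimitive_succ (hJc _).continuous]
    have h6 : ∫ t in Ioo 0 T, (((deriv (deriv χ) t : ℝ) : ℂ) * d k t + (χ t : ℂ) * d (k + 1) t)
        = ∫ t in Ioo 0 T, ((J (2 * k) t : ℂ) * d k t + (J (2 * (k + 1)) t : ℂ) * d (k + 1) t) := by
      refine setIntegral_congr_fun measurableSet_Ioo fun t ht => ?_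
      rw [hdd t ht, h4 t (by linarith [ht.1])]
    rw [h6, integral_add (hJint _ _) (hJint _ _)] at h5
    exact eq_neg_of_add_eq_zero_left h5
  have hk : ∀ k, ‖∫ t in Ioo 0 T, (J 0 t : ℂ) * d 0 t‖
      = ‖∫ t in Ioo 0 T, (J (2 * k) t : ℂ) * d k t‖ := by
    intro k
    induction k with
    | zero => rfl
    | succ k ih => rw [ih, step k, norm_neg]
  have hk' : ∀ k, ‖∫ t in Ioo 0 T, (J 0 t : ℂ) * d 0 t‖
      ≤ C * M * ((T ^ 2 * Λ) ^ k / k.factorial) := by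
    intro k
    rw [hk k]
    have hT2 : 0 ≤ T ^ (2 * k) := by rw [pow_mul]; positivity
    calc ‖∫ t in Ioo 0 T, (J (2 * k) t : ℂ) * d k t‖
        ≤ ∫ t in Ioo 0 T, ‖(J (2 * k) t : ℂ) * d k t‖ := norm_integral_le_integral_norm _
      _ ≤ ∫ t in Ioo 0 T, C * T ^ (2 * k) / (2 * k).factorial * ‖d k t‖ := by
        refine setIntegral_mono_on (hJint _ _).norm ((hint k).norm.const_mul _)
          measurableSet_Ioo fun t ht => ?_
        rw [norm_mul]
        gcongr
        simpa using hJb (2 * k) t ht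
      _ = C * T ^ (2 * k) / (2 * k).factorial * ∫ t in Ioo 0 T, ‖d k t‖ :=
        integral_const_mul _ _
      _ ≤ C * T ^ (2 * k) / (2 * k).factorial * (M * Λ ^ k) := by
        have := hbound k
        gcongr
      _ = C * M * ((T ^ 2 * Λ) ^ k / (2 * k).factorial) := by
        rw [pow_mul, mul_pow]; ring
      _ ≤ _ := by
        gcongr
        omega
  have hlim : Filter.Tendsto (fun k : ℕ => C * M * ((T ^ 2 * Λ) ^ k / k.factorial)) Filter.atTop
      (nhds (C * M * 0)) :=
    (FloorSemiring.tendsto_pow_div_factorial_atTop _).const_mul _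
  rw [mul_zero] at hlim
  have h0 := ge_of_tendsto' hlim hk'
  have h1 : ∫ t in Ioo 0 T, (J 0 t : ℂ) * d 0 t = 0 := norm_le_zero_iff.1 h0
  rw [← h1, ← integral_indicator measurableSet_Ioo]
  refine integral_congr_ae (.of_forall fun t => ?_)
  by_cases ht : t ∈ Ioo 0 T
  · simp [ht, hJ, iteratedPrimitive]
  · have : ψ t = 0 := image_eq_zero_of_notMem_tsupport fun h => ht (hψs h)
    simp [ht, this]

end

/-! ### Approximation of Schwartz functions by compactly supported ones -/

section

variable {n : ℕ}

theorem norm_laplacian_le (f : E n → ℂ) (x : E n) :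
    ‖Δ f x‖ ≤ n * ‖iteratedFDeriv ℝ 2 f x‖ := by
  rw [InnerProductSpace.laplacian_eq_iteratedFDeriv_orthonormalBasis f
    (EuclideanSpace.basisFun (Fin n) ℝ)]
  calc _ ≤ ∑ i : Fin n, ‖iteratedFDeriv ℝ 2 f x‖ := by
        refine norm_sum_le_of_le _ fun i _ => ?_
        refine (ContinuousMultilinearMap.le_opNorm _ _).trans ?_
        simp [Fin.prod_univ_two]
    _ = _ := by simp

/-- Cutting off a Schwartz function on large balls: the cut-off functions and their Laplacians are
eventually equal to the given ones at each point, and are dominated in `L²`. -/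
theorem exists_cutoff_approx (g : 𝓢(E n, ℂ)) :
    ∃ (G : ℕ → 𝓢(E n, ℂ)) (H : E n → ℝ), (∀ k, HasCompactSupport (G k)) ∧
      MemLp H 2 volume ∧ (∀ k x, ‖G k x‖ ≤ H x) ∧ (∀ k x, ‖Δ (G k) x‖ ≤ H x) ∧
      ∀ x, ∀ᶠ k in Filter.atTop, G k x = g x ∧ Δ (G k) x = Δ g x := by
  let η : ContDiffBump (0 : E n) := ⟨1, 2, by norm_num, by norm_num⟩
  have hηc : HasCompactSupport (Complex.ofRealCLM ∘ η) := η.hasCompactSupport.comp_left rfl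
  have hηs : ContDiff ℝ ∞ (Complex.ofRealCLM ∘ η) := Complex.ofRealCLM.contDiff.comp η.contDiff
  let ηS : 𝓢(E n, ℂ) := hηc.toSchwartzMap hηs
  have hη1 : ∀ x, ‖x‖ ≤ 1 → ηS x = 1 := fun x hx => by
    simp [ηS, η.one_of_mem_closedBall (x := x) (by simpa using hx)]
  set B : ℝ := ∑ i ∈ Finset.range 3, SchwartzMap.seminorm ℝ 0 i ηS with hB
  have hBi : ∀ i ∈ Finset.range 3, ∀ x, ‖iteratedFDeriv ℝ i ηS x‖ ≤ B := fun i hi x =>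
    (ηS.norm_iteratedFDeriv_le_seminorm ℝ i x).trans
      (Finset.single_le_sum (f := fun i => SchwartzMap.seminorm ℝ 0 i ηS)
        (fun _ _ => apply_nonneg _ _) hi)
  have hB0 : 0 ≤ B := Finset.sum_nonneg fun _ _ => apply_nonneg _ _
  -- Dilation factors at most `1` only shrink derivatives, so one bound `B` serves every cutoff.
  let c : ℕ → ℝ := fun k => ((k : ℝ) + 1)⁻¹
  have hc0 : ∀ k, 0 < c k := fun k => by positivity
  have hc1 : ∀ k, c k ≤ 1 := fun k => inv_le_one_of_one_le₀ (by linarith [k.cast_nonneg (α := ℝ)])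
  let e : ℕ → E n → ℂ := fun k x => ηS (c k • x)
  have hes : ∀ k, ContDiff ℝ ∞ (e k) := fun k => (ηS.smooth ⊤).comp (contDiff_const_smul _)
  have hec : ∀ k, HasCompactSupport (e k) := fun k => hηc.comp_smul (hc0 k).ne'
  have heB : ∀ k, ∀ i ∈ Finset.range 3, ∀ x, ‖iteratedFDeriv ℝ i (e k) x‖ ≤ B := by
    intro k i hi x
    rw [iteratedFDeriv_comp_const_smul (c k) (ηS.smooth i), norm_smul]
    have : ‖c k ^ i‖ ≤ 1 := by
      rw [norm_pow, Real.norm_of_nonneg (hc0 k).le]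
      exact pow_le_one₀ (hc0 k).le (hc1 k)
    calc _ ≤ 1 * B := by gcongr; exact hBi i hi _
      _ = B := one_mul _
  have hGs : ∀ k, ContDiff ℝ ∞ (fun x => e k x * g x) := fun k => (hes k).mul (g.smooth ⊤)
  have hGc : ∀ k, HasCompactSupport (fun x => e k x * g x) := fun k => (hec k).mul_right
  let G : ℕ → 𝓢(E n, ℂ) := fun k => (hGc k).toSchwartzMap (hGs k)
  let g₁ := SchwartzMap.fderivCLM ℝ (E n) ℂ g
  let g₂ := SchwartzMap.fderivCLM ℝ (E n) _ g₁
  have hg₁ : ∀ x, ‖iteratedFDeriv ℝ 1 g x‖ = ‖g₁ x‖ := fun x => by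
    rw [← norm_iteratedFDeriv_fderiv, norm_iteratedFDeriv_zero]; rfl
  have hg₂ : ∀ x, ‖iteratedFDeriv ℝ 2 g x‖ = ‖g₂ x‖ := fun x => by
    rw [← norm_iteratedFDeriv_fderiv, ← norm_iteratedFDeriv_fderiv, norm_iteratedFDeriv_zero]; rfl
  -- The coefficients 1, 2, 1 are those of the Leibniz rule for second derivatives.
  let S : E n → ℝ := fun x => ‖g x‖ + 2 * ‖g₁ x‖ + ‖g₂ x‖
  refine ⟨G, fun x => ((n : ℝ) + 1) * (B * S x), hGc, ?_, ?_, ?_, ?_⟩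
  · exact ((((g.memLp 2 volume).norm.add ((g₁.memLp 2 volume).norm.const_mul 2)).add
      (g₂.memLp 2 volume).norm).const_mul B).const_mul _
  · intro k x
    have h0 : ‖e k x‖ ≤ B := by simpa using heB k 0 (by simp) x
    calc ‖G k x‖ = ‖e k x‖ * ‖g x‖ := norm_mul _ _
      _ ≤ B * S x := by
        gcongr
        simp only [S]
        linarith [norm_nonneg (g₁ x), norm_nonneg (g₂ x)]
      _ ≤ ((n : ℝ) + 1) * (B * S x) := by
        refine le_mul_of_one_le_left (by positivity) ?_
        linarith [n.cast_nonneg (α := ℝ)]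
  · intro k x
    rw [SchwartzMap.laplacian_apply]
    refine (norm_laplacian_le _ x).trans ?_
    refine mul_le_mul (by linarith) ?_ (norm_nonneg _) (by positivity)
    · refine (norm_iteratedFDeriv_mul_le (hes k) (g.smooth ⊤) x (n := 2)
        (WithTop.coe_le_coe.2 le_top)).trans ?_
      simp only [Finset.sum_range_succ, Finset.sum_range_zero]
      norm_num
      have h0 : ‖e k x‖ ≤ B := by simpa using heB k 0 (by simp) x
      have h1 := heB k 1 (by simp) x
      have h2 := heB k 2 (by simp) x
      have hg₁' := hg₁ x
      simp only [norm_iteratedFDeriv_one] at h1 hg₁'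
      rw [hg₂, show 2 - 1 = 1 from rfl, show 2 - 2 = 0 from rfl, norm_iteratedFDeriv_zero,
        norm_iteratedFDeriv_one, hg₁']
      simp only [S]
      have a0 := mul_le_mul_of_nonneg_right h0 (norm_nonneg (g₂ x))
      have a1 := mul_le_mul_of_nonneg_right h1 (norm_nonneg (g₁ x))
      have a2 := mul_le_mul_of_nonneg_right h2 (norm_nonneg (g x))
      nlinarith
  · intro x
    obtain ⟨K, hK⟩ := exists_nat_gt ‖x‖
    filter_upwards [Filter.eventually_ge_atTop K] with k hk
    have hev : (G k : E n → ℂ) =ᶠ[nhds x] g := by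
      have : ∀ᶠ y in nhds x, ‖y‖ < K := continuous_norm.continuousAt.eventually_lt_const hK
      filter_upwards [this] with y hy
      have : e k y = 1 := by
        refine hη1 _ ?_
        rw [norm_smul, Real.norm_of_nonneg (hc0 k).le, inv_mul_le_iff₀ (by positivity)]
        have : (K : ℝ) ≤ k := mod_cast hk
        linarith
      change e k y * g y = g y
      rw [this, one_mul]
    refine ⟨hev.self_of_nhds, ?_⟩
    rw [SchwartzMap.laplacian_apply, SchwartzMap.laplacian_apply]
    exact InnerProductSpace.laplacian_congr_nhds hev |>.self_of_nhds

end

/-! ### The weak equation tested on products of functions of time and space -/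

section

variable {n : ℕ} {T : ℝ}

theorem volume_restrict_slab (n : ℕ) (T : ℝ) :
    (volume : Measure (ℝ × E n)).restrict (slab n T)
      = ((volume : Measure ℝ).restrict (Ioo 0 T)).prod (volume : Measure (E n)) := by
  rw [slab, Measure.volume_eq_prod, ← Measure.prod_restrict, Measure.restrict_univ]

theorem memLp_comp_snd {F : Type*} [NormedAddCommGroup F] {H : E n → F} (hH : MemLp H 2 volume) :
    MemLp (fun z : ℝ × E n => H z.2) 2 (volume.restrict (slab n T)) := by
  rw [volume_restrict_slab]
  exact hH.comp_snd _

theorem box_mul (χ : ℝ → ℝ) (hχ : ContDiff ℝ ∞ χ) (g : 𝓢(E n, ℂ)) (z : ℝ × E n) :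
    box (fun z => (χ z.1 : ℂ) * g z.2) z
      = -(((deriv (deriv χ) z.1 : ℝ) : ℂ) * g z.2) + (χ z.1 : ℂ) * Δ g z.2 := by
  have hd : ∀ (ψ : ℝ → ℝ) (c : ℂ), Differentiable ℝ ψ →
      deriv (fun τ => (ψ τ : ℂ) * c) = fun τ => ((deriv ψ τ : ℝ) : ℂ) * c := fun ψ c hψ =>
    funext fun τ => ((hψ τ).hasDerivAt.ofReal_comp.mul_const c).deriv
  have hχ' : ContDiff ℝ ∞ (deriv χ) := ((contDiff_infty_iff_deriv).1 hχ).2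
  have h1 : iteratedDeriv 2 (fun τ => (χ τ : ℂ) * g z.2) z.1
      = ((deriv (deriv χ) z.1 : ℝ) : ℂ) * g z.2 := by
    rw [iteratedDeriv_succ, iteratedDeriv_one, hd χ _ (hχ.differentiable (by simp)),
      hd _ _ (hχ'.differentiable (by simp))]
  have h2 : Δ (fun x => (χ z.1 : ℂ) * g x) z.2 = (χ z.1 : ℂ) * Δ g z.2 := by
    rw [SchwartzMap.laplacian_apply]
    exact InnerProductSpace.laplacian_smul (χ z.1 : ℂ) (g.contDiffAt 2)
  simp only [box]
  rw [h1, h2]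

theorem IsCauchySolution.weak_mul_of_hasCompactSupport {f₁ f₂ : E n → ℂ} {u : ℝ × E n → ℂ}
    (hu : IsCauchySolution T f₁ f₂ u) {χ : ℝ → ℝ} (hχ : ContDiff ℝ ∞ χ) (hc : HasCompactSupport χ)
    (hs : tsupport χ ⊆ Iio T) (g : 𝓢(E n, ℂ)) (hg : HasCompactSupport g) :
    ∫ z in slab n T, u z *
        (-(((deriv (deriv χ) z.1 : ℝ) : ℂ) * g z.2) + (χ z.1 : ℂ) * Δ g z.2)
      = ((deriv χ 0 : ℝ) : ℂ) * (∫ x, f₁ x * g x) - (χ 0 : ℂ) * ∫ x, f₂ x * g x := by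
  have hsub : tsupport (fun z : ℝ × E n => (χ z.1 : ℂ) * g z.2) ⊆ tsupport χ ×ˢ tsupport g := by
    refine closure_minimal (fun z hz => ?_) ((isClosed_tsupport _).prod (isClosed_tsupport _))
    simp only [Function.mem_support, ne_eq, mul_eq_zero, not_or, Complex.ofReal_eq_zero] at hz
    exact ⟨subset_tsupport _ hz.1, subset_tsupport _ hz.2⟩
  have h := hu.weak (fun z => (χ z.1 : ℂ) * g z.2) ?_ ?_ ?_
  · simp only [box_mul χ hχ g] at h
    rw [h, ← integral_const_mul, ← integral_const_mul]
    congr 1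
    · refine integral_congr_ae (.of_forall fun x => ?_)
      have hd : deriv (fun τ => (χ τ : ℂ) * g x) 0 = ((deriv χ 0 : ℝ) : ℂ) * g x :=
        (((hχ.differentiable (by simp)) 0).hasDerivAt.ofReal_comp.mul_const (g x)).deriv
      simp only [hd]
      ring
    · refine integral_congr_ae (.of_forall fun x => ?_)
      simp only
      ring
  · exact (Complex.ofRealCLM.contDiff.comp (hχ.comp contDiff_fst)).mul
      ((g.smooth ⊤).comp contDiff_snd)
  · exact HasCompactSupport.of_support_subset_isCompact (hc.isCompact.prod hg.isCompact)
      ((subset_tsupport _).trans hsub)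
  · exact hsub.trans (prod_mono hs (subset_univ _))

/-- A nonzero band-limited function never has compact support, yet it must be used as spatial test
function. Dominated convergence along the cutoffs removes the support condition in space. -/
theorem IsCauchySolution.weak_mul {f₁ f₂ : E n → ℂ} {u : ℝ × E n → ℂ}
    (hu : IsCauchySolution T f₁ f₂ u) (hf₁ : MemLp f₁ 2 volume) (hf₂ : MemLp f₂ 2 volume)
    {χ : ℝ → ℝ} (hχ : ContDiff ℝ ∞ χ) (hc : HasCompactSupport χ)
    (hs : tsupport χ ⊆ Iio T) (g : 𝓢(E n, ℂ)) :
    ∫ z in slab n T, u z *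
        (-(((deriv (deriv χ) z.1 : ℝ) : ℂ) * g z.2) + (χ z.1 : ℂ) * Δ g z.2)
      = ((deriv χ 0 : ℝ) : ℂ) * (∫ x, f₁ x * g x) - (χ 0 : ℂ) * ∫ x, f₂ x * g x := by
  obtain ⟨G, H, hGc, hH, hG, hΔ, hev⟩ := exists_cutoff_approx g
  have hχ' : ContDiff ℝ ∞ (deriv χ) := ((contDiff_infty_iff_deriv).1 hχ).2
  have hχ'' : ContDiff ℝ ∞ (deriv (deriv χ)) := ((contDiff_infty_iff_deriv).1 hχ').2
  obtain ⟨C₀, hC₀⟩ := hc.exists_bound_of_continuous hχ.continuous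
  obtain ⟨C₂, hC₂⟩ := hc.deriv.deriv.exists_bound_of_continuous hχ''.continuous
  have hC₀' : 0 ≤ C₀ := (norm_nonneg _).trans (hC₀ 0)
  have hC₂' : 0 ≤ C₂ := (norm_nonneg _).trans (hC₂ 0)
  have hlhs : Filter.Tendsto (fun k => ∫ z in slab n T, u z *
      (-(((deriv (deriv χ) z.1 : ℝ) : ℂ) * G k z.2) + (χ z.1 : ℂ) * Δ (G k) z.2)) Filter.atTop
      (nhds (∫ z in slab n T, u z *
        (-(((deriv (deriv χ) z.1 : ℝ) : ℂ) * g z.2) + (χ z.1 : ℂ) * Δ g z.2))) := by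
    refine tendsto_integral_of_dominated_convergence
      (fun z => ‖u z‖ * ((C₂ + C₀) * H z.2)) ?_ ?_ ?_ ?_
    · intro k
      refine hu.memLp.1.mul (Continuous.aestronglyMeasurable ?_)
      have h1 := hχ''.continuous
      have h2 := hχ.continuous
      have h3 := (G k).continuous
      have h4 := (Δ (G k)).continuous
      fun_prop
    · exact MemLp.integrable_mul hu.memLp.norm ((memLp_comp_snd hH).const_mul _)
    · refine fun k => .of_forall fun z => ?_
      rw [norm_mul]
      gcongr
      refine (norm_add_le _ _).trans ?_
      rw [norm_neg, norm_mul, norm_mul, add_mul, Complex.norm_real, Complex.norm_real]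
      gcongr
      · exact hC₂ _
      · exact hG k _
      · exact hC₀ _
      · exact hΔ k _
    · refine .of_forall fun z => ?_
      refine tendsto_nhds_of_eventually_eq ?_
      filter_upwards [hev z.2] with k hk
      rw [hk.1, hk.2]
  have hrhs : ∀ f : E n → ℂ, MemLp f 2 volume → Filter.Tendsto (fun k => ∫ x, f x * G k x)
      Filter.atTop (nhds (∫ x, f x * g x)) := by
    intro f hf
    refine tendsto_integral_of_dominated_convergence (fun x => ‖f x‖ * H x) ?_ ?_ ?_ ?_
    · exact fun k => hf.1.mul (G k).continuous.aestronglyMeasurable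
    · exact MemLp.integrable_mul hf.norm hH
    · refine fun k => .of_forall fun x => ?_
      rw [norm_mul]
      gcongr
      exact hG k x
    · refine .of_forall fun x => tendsto_nhds_of_eventually_eq ?_
      filter_upwards [hev x] with k hk
      rw [hk.1]
  refine tendsto_nhds_unique hlhs ?_
  simp only [fun k => hu.weak_mul_of_hasCompactSupport hχ hc hs (G k) (hGc k)]
  exact ((hrhs f₁ hf₁).const_mul _).sub ((hrhs f₂ hf₂).const_mul _)

end

/-! ### The wave multiplier and the harmonic oscillator -/

section

variable {n : ℕ} {T : ℝ}

/-- The frequency `2π‖ξ‖`, whose square is the symbol of `-Δ`. -/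
noncomputable def freq (ξ : E n) : ℝ := 2 * Real.pi * ‖ξ‖

theorem freq_nonneg (ξ : E n) : 0 ≤ freq ξ := by unfold freq; positivity

theorem continuous_freq : Continuous (freq : E n → ℝ) := by unfold freq; fun_prop

/-- The spatial Fourier transform at time `t` of the solution of the wave equation with Cauchy
data `(f₁, f₂)`. -/
noncomputable def waveSymbol (f₁ f₂ : E n → ℂ) (t : ℝ) (ξ : E n) : ℂ :=
  l2Fourier f₁ ξ * (Real.cos (freq ξ * t) : ℝ) +
    l2Fourier f₂ ξ * (t * Real.sinc (freq ξ * t) : ℝ)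

/-- `t * Real.sinc (l * t)` is `sin(lt)/l` with its limit `t` at `l = 0`, so zero frequency needs no
separate formula. -/
theorem mul_mul_sinc (l t : ℝ) : l * (t * Real.sinc (l * t)) = Real.sin (l * t) := by
  rcases eq_or_ne (l * t) 0 with h | h
  · rw [h]; simp [h]
  · rw [Real.sinc_of_ne_zero h, ← mul_assoc, mul_div_cancel₀ _ h]

theorem hasDerivAt_mul_sinc (l t : ℝ) :
    HasDerivAt (fun t => t * Real.sinc (l * t)) (Real.cos (l * t)) t := by
  rcases eq_or_ne l 0 with rfl | hl
  · simpa using hasDerivAt_id' t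
  · have h1 : (fun t => t * Real.sinc (l * t)) = fun t => Real.sin (l * t) / l := by
      funext s
      rw [← mul_mul_sinc, mul_div_cancel_left₀ _ hl]
    rw [h1]
    have h2 := (((hasDerivAt_id t).const_mul l).sin).div_const l
    simpa [hl] using h2

theorem norm_waveSymbol_le (f₁ f₂ : E n → ℂ) (t : ℝ) (ξ : E n) :
    ‖waveSymbol f₁ f₂ t ξ‖ ≤ ‖l2Fourier f₁ ξ‖ + |t| * ‖l2Fourier f₂ ξ‖ := by
  unfold waveSymbol
  refine (norm_add_le _ _).trans ?_
  rw [norm_mul, norm_mul, Complex.norm_real, Complex.norm_real, Real.norm_eq_abs,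
    Real.norm_eq_abs, abs_mul]
  have h1 := Real.abs_cos_le_one (freq ξ * t)
  have h2 := Real.abs_sinc_le_one (freq ξ * t)
  refine add_le_add (mul_le_of_le_one_right (norm_nonneg _) h1) ?_
  rw [mul_comm]
  gcongr
  exact mul_le_of_le_one_right (abs_nonneg _) h2

theorem aestronglyMeasurable_waveSymbol {α : Type*} [MeasurableSpace α] {μ : Measure α}
    (f₁ f₂ : E n → ℂ) {τ : α → ℝ} {x : α → E n} (hτ : Measurable τ)
    (hx : Measure.QuasiMeasurePreserving x μ volume) :
    AEStronglyMeasurable (fun a => waveSymbol f₁ f₂ (τ a) (x a)) μ := by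
  have h1 := (memLp_l2Fourier f₁).1.comp_quasiMeasurePreserving hx
  have h2 := (memLp_l2Fourier f₂).1.comp_quasiMeasurePreserving hx
  have hf : Measurable (fun a => freq (x a)) := continuous_freq.measurable.comp hx.1
  refine (h1.mul ?_).add (h2.mul ?_)
  · exact (Complex.measurable_ofReal.comp
      (Real.measurable_cos.comp (hf.mul hτ))).aestronglyMeasurable
  · exact (Complex.measurable_ofReal.comp (hτ.mul
      (Real.continuous_sinc.measurable.comp (hf.mul hτ)))).aestronglyMeasurable

theorem memLp_waveSymbol_slab (f₁ f₂ : E n → ℂ) (T : ℝ) :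
    MemLp (fun z : ℝ × E n => waveSymbol f₁ f₂ z.1 z.2) 2 (volume.restrict (slab n T)) := by
  have hb := memLp_comp_snd (T := T)
    ((memLp_l2Fourier f₁).norm.add ((memLp_l2Fourier f₂).norm.const_mul T))
  refine hb.of_le (f := fun z : ℝ × E n => waveSymbol f₁ f₂ z.1 z.2) ?_ ?_
  · rw [volume_restrict_slab]
    exact aestronglyMeasurable_waveSymbol f₁ f₂ measurable_fst Measure.quasiMeasurePreserving_snd
  · refine (ae_restrict_iff' (measurableSet_Ioo.prod .univ)).2 (.of_forall fun z hz => ?_)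
    refine (norm_waveSymbol_le f₁ f₂ z.1 z.2).trans (le_trans ?_ (Real.le_norm_self _))
    simp only [Pi.add_apply]
    gcongr
    rw [abs_of_pos hz.1.1]
    exact hz.1.2.le

theorem memLp_waveSymbol (f₁ f₂ : E n → ℂ) (t : ℝ) : MemLp (waveSymbol f₁ f₂ t) 2 volume := by
  have hb := (memLp_l2Fourier f₁).norm.add ((memLp_l2Fourier f₂).norm.const_mul |t|)
  refine hb.of_le (aestronglyMeasurable_waveSymbol f₁ f₂ measurable_const
    (Measure.QuasiMeasurePreserving.id _)) (.of_forall fun ξ => ?_)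
  exact (norm_waveSymbol_le f₁ f₂ t ξ).trans (Real.le_norm_self _)

/-- Green's identity for the harmonic oscillator. -/
theorem integral_oscillator (hT : 0 < T) (l : ℝ) (a b : ℂ) {χ : ℝ → ℝ} (hχ : ContDiff ℝ ∞ χ)
    (hs : tsupport χ ⊆ Iio T) :
    ∫ t in Ioo 0 T, (a * (Real.cos (l * t) : ℝ) + b * (t * Real.sinc (l * t) : ℝ)) *
        (-((deriv (deriv χ) t : ℝ) : ℂ) - (χ t : ℂ) * ((l ^ 2 : ℝ) : ℂ))
      = ((deriv χ 0 : ℝ) : ℂ) * a - (χ 0 : ℂ) * b := by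
  have hχ' : ContDiff ℝ ∞ (deriv χ) := ((contDiff_infty_iff_deriv).1 hχ).2
  have hχ'' : ContDiff ℝ ∞ (deriv (deriv χ)) := ((contDiff_infty_iff_deriv).1 hχ').2
  have hT0 : χ T = 0 := image_eq_zero_of_notMem_tsupport fun h => lt_irrefl T (hs h)
  have hT1 : deriv χ T = 0 :=
    image_eq_zero_of_notMem_tsupport fun h => lt_irrefl T (hs (tsupport_deriv_subset h))
  rw [← integral_Ioc_eq_integral_Ioo, ← intervalIntegral.integral_of_le hT.le]
  -- The primitive is the Wronskian `-χ'w + χw'` of `χ` and the oscillation `w`; it vanishes at `T`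
  -- because `χ` and `χ'` do.
  rw [intervalIntegral.integral_eq_sub_of_hasDerivAt (f := fun t =>
    -((deriv χ t : ℝ) : ℂ) * (a * (Real.cos (l * t) : ℝ) + b * (t * Real.sinc (l * t) : ℝ))
      + (χ t : ℂ) * (-(a * ((Real.sin (l * t) * l : ℝ) : ℂ)) + b * (Real.cos (l * t) : ℝ)))]
  · simp [hT0, hT1]
    ring
  · intro t _
    have h1 : HasDerivAt (fun t => ((deriv χ t : ℝ) : ℂ)) ((deriv (deriv χ) t : ℝ) : ℂ) t :=
      ((hχ'.differentiable (by simp)) t).hasDerivAt.ofReal_comp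
    have h0 : HasDerivAt (fun t => (χ t : ℂ)) ((deriv χ t : ℝ) : ℂ) t :=
      ((hχ.differentiable (by simp)) t).hasDerivAt.ofReal_comp
    have hl : HasDerivAt (fun t => l * t) l t := by simpa using (hasDerivAt_id t).const_mul l
    have h2 : HasDerivAt (fun t => ((Real.cos (l * t) : ℝ) : ℂ))
        ((-Real.sin (l * t) * l : ℝ) : ℂ) t := hl.cos.ofReal_comp
    have h3 : HasDerivAt (fun t => ((t * Real.sinc (l * t) : ℝ) : ℂ))
        ((Real.cos (l * t) : ℝ) : ℂ) t := (hasDerivAt_mul_sinc l t).ofReal_comp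
    have h4 : HasDerivAt (fun t => ((Real.sin (l * t) * l : ℝ) : ℂ))
        ((Real.cos (l * t) * l * l : ℝ) : ℂ) t := (hl.sin.mul_const l).ofReal_comp
    have h5 := (h1.neg.mul ((h2.const_mul a).add (h3.const_mul b))).add
      (h0.mul ((h4.const_mul a).neg.add (h2.const_mul b)))
    refine h5.congr_deriv ?_
    -- Once the sine is written through `t sinc(lt)`, the identity is polynomial and holds without
    -- dividing by `l`.
    rw [show (((-Real.sin (l * t) * l : ℝ)) : ℂ)
      = -(((l : ℂ) * (l * (t * Real.sinc (l * t)) : ℝ))) by rw [mul_mul_sinc]; push_cast; ring]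
    simp only [Pi.add_apply, Pi.neg_apply]
    rw [show (((Real.sin (l * t) * l : ℝ)) : ℂ)
      = (((l : ℂ) * (l * (t * Real.sinc (l * t)) : ℝ))) by rw [mul_mul_sinc]; push_cast; ring]
    push_cast
    ring
  · apply Continuous.intervalIntegrable
    have := hχ''.continuous
    have := hχ.continuous
    have := Real.continuous_sinc
    fun_prop

end

/-! ### Pairings with time slices, and the Laplacian on the Fourier side -/

section

variable {n : ℕ} {T : ℝ}

theorem ae_memLp_slice {w : ℝ × E n → ℂ} (hw : MemLp w 2 (volume.restrict (slab n T))) :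
    ∀ᵐ t ∂(volume.restrict (Ioo 0 T)), MemLp (fun x => w (t, x)) 2 volume := by
  rw [volume_restrict_slab] at hw
  filter_upwards [hw.1.prodMk_left,
    ((memLp_two_iff_integrable_sq_norm hw.1).1 hw).prod_right_ae] with t h1 h2
  exact (memLp_two_iff_integrable_sq_norm h1).2 h2

theorem integrable_slab_mul {w : ℝ × E n → ℂ} (hw : MemLp w 2 (volume.restrict (slab n T)))
    {p : E n → ℂ} (hp : MemLp p 2 volume) :
    Integrable (fun z => w z * p z.2) ((volume.restrict (Ioo 0 T)).prod volume) := by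
  have := MemLp.integrable_mul hw (memLp_comp_snd (T := T) hp)
  rwa [volume_restrict_slab] at this

theorem integrableOn_pairing {w : ℝ × E n → ℂ} (hw : MemLp w 2 (volume.restrict (slab n T)))
    {p : E n → ℂ} (hp : MemLp p 2 volume) :
    IntegrableOn (fun t => ∫ x, w (t, x) * p x) (Ioo 0 T) :=
  (integrable_slab_mul hw hp).integral_prod_left

theorem eLpNorm_comp_snd {α : Type*} [MeasurableSpace α] (μ : Measure α) {p : E n → ℂ}
    (hp : MemLp p 2 volume) :
    eLpNorm (fun z : α × E n => p z.2) 2 (μ.prod volume)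
      = μ univ ^ (1 / 2 : ℝ) * eLpNorm p 2 volume := by
  have : eLpNorm (p ∘ Prod.snd) 2 (μ.prod volume)
      = eLpNorm p 2 ((μ.prod volume).map Prod.snd) := by
    refine (eLpNorm_map_measure ?_ measurable_snd.aemeasurable).symm
    rw [Measure.map_snd_prod]
    exact hp.1.smul_measure _
  change eLpNorm (p ∘ Prod.snd) 2 _ = _
  rw [this, Measure.map_snd_prod, eLpNorm_smul_measure_of_ne_top (by norm_num)]
  simp

theorem integral_norm_mul_le {α : Type*} [MeasurableSpace α] {μ : Measure α} {f g : α → ℂ}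
    (hf : MemLp f 2 μ) (hg : MemLp g 2 μ) :
    ∫ a, ‖f a * g a‖ ∂μ ≤ (eLpNorm f 2 μ).toReal * (eLpNorm g 2 μ).toReal := by
  rw [integral_norm_eq_lintegral_enorm
    (show AEStronglyMeasurable (fun a => f a * g a) μ from hf.1.mul hg.1), ← eLpNorm_one_eq_lintegral_enorm,
    ← ENNReal.toReal_mul]
  refine ENNReal.toReal_mono (ENNReal.mul_ne_top hf.2.ne hg.2.ne) ?_
  have := eLpNorm_smul_le_mul_eLpNorm (p := 2) (q := 2) (r := 1) hg.1 hf.1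
  exact this

/-- Cauchy–Schwarz on the slab. What matters is that `K` does not depend on `p`: geometric growth of
the norms of a sequence of test functions then passes to their pairings. -/
theorem integral_norm_pairing_le {w : ℝ × E n → ℂ}
    (hw : MemLp w 2 (volume.restrict (slab n T))) :
    ∃ K : ℝ, 0 ≤ K ∧ ∀ p : E n → ℂ, MemLp p 2 volume →
      ∫ t in Ioo 0 T, ‖∫ x, w (t, x) * p x‖ ≤ K * (eLpNorm p 2 volume).toReal := by
  refine ⟨(eLpNorm w 2 (volume.restrict (slab n T))).toReal *
    (((volume.restrict (Ioo 0 T) : Measure ℝ) univ) ^ (1 / 2 : ℝ)).toReal, by positivity,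
    fun p hp => ?_⟩
  have hi := integrable_slab_mul hw hp
  have h1 : ∫ t in Ioo 0 T, ‖∫ x, w (t, x) * p x‖
      ≤ ∫ z, ‖w z * p z.2‖ ∂((volume.restrict (Ioo 0 T)).prod volume) := by
    rw [integral_prod _ hi.norm]
    exact integral_mono (integrableOn_pairing hw hp).norm hi.norm.integral_prod_left
      fun t => norm_integral_le_integral_norm _
  refine h1.trans ?_
  have hp' := memLp_comp_snd (T := T) hp
  rw [← volume_restrict_slab]
  refine (integral_norm_mul_le hw hp').trans_eq ?_
  rw [mul_assoc, volume_restrict_slab, eLpNorm_comp_snd _ hp, ENNReal.toReal_mul]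

theorem integral_slab_mul_eq {w : ℝ × E n → ℂ} (hw : MemLp w 2 (volume.restrict (slab n T)))
    {p q : E n → ℂ} (hp : MemLp p 2 volume) (hq : MemLp q 2 volume) {α β : ℝ → ℝ}
    (hα : Continuous α) (hα' : HasCompactSupport α) (hβ : Continuous β)
    (hβ' : HasCompactSupport β) :
    ∫ z in slab n T, w z * (-((α z.1 : ℂ) * p z.2) - (β z.1 : ℂ) * q z.2)
      = -∫ t in Ioo 0 T, ((α t : ℂ) * (∫ x, w (t, x) * p x) + (β t : ℂ) * ∫ x, w (t, x) * q x) := by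
  have hb : ∀ {γ : ℝ → ℝ} {r : E n → ℂ}, Continuous γ → HasCompactSupport γ → MemLp r 2 volume →
      Integrable (fun z : ℝ × E n => (γ z.1 : ℂ) * (w z * r z.2))
        ((volume.restrict (Ioo 0 T)).prod volume) := by
    intro γ r hγ hγ' hr
    obtain ⟨C, hC⟩ := hγ'.exists_bound_of_continuous hγ
    refine (integrable_slab_mul hw hr).bdd_mul (c := C) ?_ (.of_forall fun z => ?_)
    · exact (Complex.continuous_ofReal.comp (hγ.comp continuous_fst)).aestronglyMeasurable
    · simpa using hC z.1
  have h1 := hb hα hα' hp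
  have h2 := hb hβ hβ' hq
  rw [volume_restrict_slab]
  have e : ∀ z : ℝ × E n, w z * (-((α z.1 : ℂ) * p z.2) - (β z.1 : ℂ) * q z.2)
      = -((α z.1 : ℂ) * (w z * p z.2) + (β z.1 : ℂ) * (w z * q z.2)) := fun z => by ring
  simp only [e]
  rw [integral_neg, integral_prod _ (show Integrable (fun z : ℝ × E n =>
    (α z.1 : ℂ) * (w z * p z.2) + (β z.1 : ℂ) * (w z * q z.2)) _ from h1.add h2)]
  congr 1
  refine integral_congr_ae ?_
  filter_upwards [h1.prod_right_ae, h2.prod_right_ae] with t ht1 ht2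
  rw [← integral_const_mul, ← integral_const_mul, ← integral_add ht1 ht2]

/-- Multiplication of a Schwartz function by the symbol of `-Δ`. -/
noncomputable def mulFreqSq (h : 𝓢(E n, ℂ)) : 𝓢(E n, ℂ) :=
  (2 * Real.pi) ^ 2 • SchwartzMap.smulLeftCLM ℂ (fun ξ : E n => ‖ξ‖ ^ 2) h

theorem mulFreqSq_apply (h : 𝓢(E n, ℂ)) (ξ : E n) :
    mulFreqSq h ξ = ((freq ξ ^ 2 : ℝ) : ℂ) * h ξ := by
  have : (fun ξ : E n => ‖ξ‖ ^ 2).HasTemperateGrowth := by fun_prop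
  simp only [mulFreqSq, smul_apply, SchwartzMap.smulLeftCLM_apply_apply this, Complex.real_smul,
    freq]
  push_cast
  ring

theorem laplacian_fourier (h : 𝓢(E n, ℂ)) : Δ (𝓕 h) = -𝓕 (mulFreqSq h) := by
  have hsum : ∀ a : Fin n → 𝓢(E n, ℂ), ∑ i, 𝓕 (a i) = 𝓕 (∑ i, a i) := fun a =>
    (map_sum (SchwartzMap.fourierTransformCLM ℂ) a Finset.univ).symm
  have hneg : -𝓕 (mulFreqSq h) = 𝓕 (-mulFreqSq h) :=
    (map_neg (SchwartzMap.fourierTransformCLM ℂ) _).symm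
  let b := EuclideanSpace.basisFun (Fin n) ℝ
  rw [SchwartzMap.laplacian_eq_sum b]
  simp only [SchwartzMap.lineDerivOp_fourier_eq]
  rw [hsum, hneg]
  congr 1
  ext ξ
  have ht : ∀ m : E n, (fun ξ : E n => inner ℝ ξ m).HasTemperateGrowth := fun m => by fun_prop
  have hn : ‖ξ‖ ^ 2 = ∑ i, inner ℝ ξ (b i) ^ 2 := by
    rw [← b.sum_sq_inner_left]
  rw [neg_apply, mulFreqSq_apply, freq, mul_pow, hn, sum_apply]
  simp only [smul_apply, SchwartzMap.smulLeftCLM_apply_apply (ht _), Complex.real_smul, smul_eq_mul]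
  push_cast
  rw [Finset.mul_sum, Finset.sum_mul, ← Finset.sum_neg_distrib]
  refine Finset.sum_congr rfl fun i _ => ?_
  linear_combination ((2 * Real.pi : ℂ) ^ 2 * ((inner ℝ ξ (b i) : ℝ) : ℂ) ^ 2 * h ξ) * Complex.I_sq

end

/-! ### Fourier representation of weak solutions -/

section

variable {n : ℕ} {T : ℝ}

theorem mulFreqSq_iterate_apply (h : 𝓢(E n, ℂ)) (k : ℕ) (ξ : E n) :
    (mulFreqSq^[k] h) ξ = ((freq ξ ^ 2 : ℝ) : ℂ) ^ k * h ξ := by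
  induction k with
  | zero => simp
  | succ k ih => rw [Function.iterate_succ_apply', mulFreqSq_apply, ih]; ring

theorem eLpNorm_fourier (h : 𝓢(E n, ℂ)) :
    eLpNorm (𝓕 h : 𝓢(E n, ℂ)) 2 volume = eLpNorm h 2 volume := by
  have := SchwartzMap.norm_fourier_toL2_eq h
  rw [SchwartzMap.norm_toLp, SchwartzMap.norm_toLp] at this
  exact (ENNReal.toReal_eq_toReal_iff' ((𝓕 h).memLp 2 volume).2.ne (h.memLp 2 volume).2.ne).1 this

/-- With `h` replaced by the `k`-th power of the symbol of `-Δ` times `h`, the difference of the two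
sides satisfies the weak recursion: both sides obey the same equation with the same data. Compact
support of `h` bounds the symbol on it, which gives growth `Λ ^ k`. -/
theorem IsCauchySolution.ae_pairing_eq {f₁ f₂ : E n → ℂ} {u : ℝ × E n → ℂ} (hT : 0 < T)
    (hu : IsCauchySolution T f₁ f₂ u) (hf₁ : MemLp f₁ 2 volume) (hf₂ : MemLp f₂ 2 volume)
    (h : 𝓢(E n, ℂ)) (hc : HasCompactSupport h) :
    ∀ᵐ t ∂(volume.restrict (Ioo 0 T)),
      ∫ x, u (t, x) * 𝓕 h x = ∫ ξ, waveSymbol f₁ f₂ t ξ * h ξ := by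
  let V : ℝ × E n → ℂ := fun z => waveSymbol f₁ f₂ z.1 z.2
  have hV : MemLp V 2 (volume.restrict (slab n T)) := memLp_waveSymbol_slab f₁ f₂ T
  obtain ⟨K₁, hK₁, hb₁⟩ := integral_norm_pairing_le hu.memLp
  obtain ⟨K₂, hK₂, hb₂⟩ := integral_norm_pairing_le hV
  obtain ⟨R, hR⟩ := hc.isCompact.isBounded.exists_norm_le
  have hmem : ∀ g : 𝓢(E n, ℂ), MemLp g 2 volume := fun g => g.memLp 2 volume
  -- When `h` has empty support, `R` may be negative.
  set R' := max R 0 with hR'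
  set Λ : ℝ := (2 * Real.pi * R') ^ 2 with hΛ
  set N := (eLpNorm h 2 volume).toReal with hN
  have hgrow : ∀ k, (eLpNorm (mulFreqSq^[k] h) 2 volume).toReal ≤ Λ ^ k * N := by
    intro k
    have h1 : eLpNorm (mulFreqSq^[k] h) 2 volume ≤ ENNReal.ofReal (Λ ^ k) * eLpNorm h 2 volume := by
      refine eLpNorm_le_mul_eLpNorm_of_ae_le_mul (.of_forall fun ξ => ?_) 2
      rw [mulFreqSq_iterate_apply, norm_mul, norm_pow, Complex.norm_real]
      by_cases hξ : ξ ∈ tsupport h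
      · have : freq ξ ^ 2 ≤ Λ := by
          rw [hΛ, freq]
          gcongr
          exact (hR ξ hξ).trans (le_max_left _ _)
        gcongr
        rwa [Real.norm_of_nonneg (by positivity)]
      · simp [image_eq_zero_of_notMem_tsupport hξ]
    calc _ ≤ (ENNReal.ofReal (Λ ^ k) * eLpNorm h 2 volume).toReal :=
          ENNReal.toReal_mono (ENNReal.mul_ne_top ENNReal.ofReal_ne_top (hmem h).2.ne) h1
      _ = _ := by rw [ENNReal.toReal_mul, ENNReal.toReal_ofReal (by positivity)]
  have hi₁ : ∀ k, IntegrableOn (fun t => ∫ x, u (t, x) * 𝓕 (mulFreqSq^[k] h) x) (Ioo 0 T) :=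
    fun k => integrableOn_pairing hu.memLp (hmem (𝓕 (mulFreqSq^[k] h)))
  have hi₂ : ∀ k, IntegrableOn (fun t => ∫ ξ, V (t, ξ) * (mulFreqSq^[k] h) ξ) (Ioo 0 T) :=
    fun k => integrableOn_pairing hV (hmem (mulFreqSq^[k] h))
  have key := ae_eq_zero_of_weak_recursion (T := T) (Λ := Λ) (M := (K₁ + K₂) * N)
    (by positivity) (by positivity)
    (fun k t => (∫ x, u (t, x) * 𝓕 (mulFreqSq^[k] h) x) - ∫ ξ, V (t, ξ) * (mulFreqSq^[k] h) ξ)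
    (fun k => (hi₁ k).sub (hi₂ k)) ?_ ?_
  · rw [ae_restrict_iff' measurableSet_Ioo]
    filter_upwards [key] with t ht htT
    exact sub_eq_zero.1 (ht htT)
  · intro k
    calc ∫ t in Ioo 0 T, ‖(∫ x, u (t, x) * 𝓕 (mulFreqSq^[k] h) x)
            - ∫ ξ, V (t, ξ) * (mulFreqSq^[k] h) ξ‖
        ≤ ∫ t in Ioo 0 T, (‖∫ x, u (t, x) * 𝓕 (mulFreqSq^[k] h) x‖
            + ‖∫ ξ, V (t, ξ) * (mulFreqSq^[k] h) ξ‖) :=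
          integral_mono ((hi₁ k).sub (hi₂ k)).norm ((hi₁ k).norm.add (hi₂ k).norm)
            fun t => norm_sub_le _ _
      _ ≤ K₁ * (Λ ^ k * N) + K₂ * (Λ ^ k * N) := by
        rw [integral_add (hi₁ k).norm (hi₂ k).norm]
        refine add_le_add ((hb₁ _ (hmem _)).trans ?_) ((hb₂ _ (hmem _)).trans ?_)
        · rw [eLpNorm_fourier]
          gcongr
          exact hgrow k
        · gcongr
          exact hgrow k
      _ = (K₁ + K₂) * N * Λ ^ k := by ring
  · intro k χ hχ hχc hχs
    set g := mulFreqSq^[k] h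
    have hg : mulFreqSq^[k + 1] h = mulFreqSq g := Function.iterate_succ_apply' _ _ _
    simp only [hg]
    have hχ' : ContDiff ℝ ∞ (deriv χ) := ((contDiff_infty_iff_deriv).1 hχ).2
    have hχ'' : ContDiff ℝ ∞ (deriv (deriv χ)) := ((contDiff_infty_iff_deriv).1 hχ').2
    have eu := hu.weak_mul hf₁ hf₂ hχ hχc hχs (𝓕 g)
    rw [laplacian_fourier] at eu
    simp only [neg_apply, mul_neg, ← sub_eq_add_neg] at eu
    rw [integral_slab_mul_eq hu.memLp (hmem (𝓕 g)) (hmem (𝓕 (mulFreqSq g))) hχ''.continuous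
      hχc.deriv.deriv hχ.continuous hχc, ← integral_l2Fourier_mul hf₁,
      ← integral_l2Fourier_mul hf₂] at eu
    have eV := integral_slab_mul_eq hV (hmem g) (hmem (mulFreqSq g)) hχ''.continuous
      hχc.deriv.deriv hχ.continuous hχc
    have eV' : ∫ z in slab n T, V z * (-(((deriv (deriv χ) z.1 : ℝ) : ℂ) * g z.2)
          - (χ z.1 : ℂ) * mulFreqSq g z.2)
        = ((deriv χ 0 : ℝ) : ℂ) * (∫ x, l2Fourier f₁ x * g x)
          - (χ 0 : ℂ) * ∫ x, l2Fourier f₂ x * g x := by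
      have hint : Integrable (fun z : ℝ × E n => V z * (-(((deriv (deriv χ) z.1 : ℝ) : ℂ) * g z.2)
          - (χ z.1 : ℂ) * mulFreqSq g z.2)) ((volume.restrict (Ioo 0 T)).prod volume) := by
        obtain ⟨C₀, hC₀⟩ := hχc.exists_bound_of_continuous hχ.continuous
        obtain ⟨C₂, hC₂⟩ := hχc.deriv.deriv.exists_bound_of_continuous hχ''.continuous
        have a1 := (integrable_slab_mul hV (hmem g)).bdd_mul (c := C₂)
          (f := fun z => ((deriv (deriv χ) z.1 : ℝ) : ℂ))
          (Complex.continuous_ofReal.comp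
            (hχ''.continuous.comp continuous_fst)).aestronglyMeasurable
          (.of_forall fun z => by simpa using hC₂ z.1)
        have a2 := (integrable_slab_mul hV (hmem (mulFreqSq g))).bdd_mul (c := C₀)
          (f := fun z => (χ z.1 : ℂ))
          (Complex.continuous_ofReal.comp
            (hχ.continuous.comp continuous_fst)).aestronglyMeasurable
          (.of_forall fun z => by simpa using hC₀ z.1)
        refine (a1.neg.sub a2).congr (.of_forall fun z => ?_)
        simp only [Pi.sub_apply, Pi.neg_apply]
        ring
      rw [volume_restrict_slab, integral_prod_symm _ hint]
      -- At fixed frequency the wave multiplier is an oscillation with initial values `f̂₁(ξ)`,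
      -- `f̂₂(ξ)`, so Green's identity applies pointwise in `ξ`.
      have : ∀ ξ, ∫ t in Ioo 0 T, V (t, ξ) * (-(((deriv (deriv χ) t : ℝ) : ℂ) * g ξ)
            - (χ t : ℂ) * mulFreqSq g ξ)
          = ((deriv χ 0 : ℝ) : ℂ) * (l2Fourier f₁ ξ * g ξ) - (χ 0 : ℂ) * (l2Fourier f₂ ξ * g ξ) := by
        intro ξ
        have := integral_oscillator hT (freq ξ) (l2Fourier f₁ ξ) (l2Fourier f₂ ξ) hχ hχs
        calc _ = ∫ t in Ioo 0 T, (l2Fourier f₁ ξ * (Real.cos (freq ξ * t) : ℝ)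
              + l2Fourier f₂ ξ * (t * Real.sinc (freq ξ * t) : ℝ)) *
              (-((deriv (deriv χ) t : ℝ) : ℂ) - (χ t : ℂ) * ((freq ξ ^ 2 : ℝ) : ℂ)) * g ξ := by
              refine integral_congr_ae (.of_forall fun t => ?_)
              simp only [V, waveSymbol, mulFreqSq_apply]
              ring
          _ = _ := by
              rw [integral_mul_const, this]
              ring
      simp only [this]
      rw [integral_sub ((integrable_mul_schwartz (memLp_l2Fourier f₁) g).const_mul _)
        ((integrable_mul_schwartz (memLp_l2Fourier f₂) g).const_mul _), integral_const_mul,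
        integral_const_mul]
    rw [eV, ← eu, neg_inj] at eV'
    have hb : ∀ {w : ℝ → ℂ} {γ : ℝ → ℝ}, IntegrableOn w (Ioo 0 T) → Continuous γ →
        HasCompactSupport γ → IntegrableOn (fun t => (γ t : ℂ) * w t) (Ioo 0 T) := by
      intro w γ hw hγ hγ'
      obtain ⟨C, hC⟩ := hγ'.exists_bound_of_continuous hγ
      exact hw.bdd_mul (c := C) (Complex.continuous_ofReal.comp hγ).aestronglyMeasurable
        (.of_forall fun t => by simpa using hC t)
    have b1 := hb (integrableOn_pairing hu.memLp (hmem (𝓕 g))) hχ''.continuous hχc.deriv.deriv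
    have b2 := hb (integrableOn_pairing hu.memLp (hmem (𝓕 (mulFreqSq g)))) hχ.continuous hχc
    have b3 := hb (integrableOn_pairing hV (hmem g)) hχ''.continuous hχc.deriv.deriv
    have b4 := hb (integrableOn_pairing hV (hmem (mulFreqSq g))) hχ.continuous hχc
    have eW := (integral_sub (b3.add b4) (b1.add b2)).trans (sub_eq_zero.2 eV')
    rw [← neg_eq_zero, ← integral_neg, ← eW]
    refine integral_congr_ae (.of_forall fun t => ?_)
    simp only [Pi.add_apply]
    ring

/-- Square-integrable functions on the slab whose time slices have the Fourier transform of the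
solution of the wave equation with Cauchy data `(f₁, f₂)`. -/
structure IsSpectralSolution (T : ℝ) (f₁ f₂ : E n → ℂ) (u : ℝ × E n → ℂ) : Prop where
  memLp : MemLp u 2 (volume.restrict (slab n T))
  memLp₁ : MemLp f₁ 2 volume
  memLp₂ : MemLp f₂ 2 volume
  slice : ∀ᵐ t ∂(volume.restrict (Ioo 0 T)), MemLp (fun x => u (t, x)) 2 volume ∧
    l2Fourier (fun x => u (t, x)) =ᵐ[volume] waveSymbol f₁ f₂ t

theorem IsCauchySolution.isSpectralSolution {f₁ f₂ : E n → ℂ} {u : ℝ × E n → ℂ} (hT : 0 < T)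
    (hu : IsCauchySolution T f₁ f₂ u) (hf₁ : MemLp f₁ 2 volume) (hf₂ : MemLp f₂ 2 volume) :
    IsSpectralSolution T f₁ f₂ u := by
  refine ⟨hu.memLp, hf₁, hf₂, ?_⟩
  -- Countably many test functions leave one null set of exceptional times, independent of the test
  -- function.
  obtain ⟨H, hHc, hH⟩ := exists_countable_separating n
  filter_upwards [ae_memLp_slice hu.memLp,
    ae_all_iff.2 fun i => hu.ae_pairing_eq hT hf₁ hf₂ (H i) (hHc i)] with t ht hi
  refine ⟨ht, hH _ _ (memLp_l2Fourier _) (memLp_waveSymbol f₁ f₂ t) fun i => ?_⟩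
  rw [integral_l2Fourier_mul ht]
  exact hi i

theorem IsSpectralSolution.sub {f₁ f₂ g₁ g₂ : E n → ℂ} {u v : ℝ × E n → ℂ}
    (hu : IsSpectralSolution T f₁ f₂ u) (hv : IsSpectralSolution T g₁ g₂ v) :
    IsSpectralSolution T (f₁ - g₁) (f₂ - g₂) (u - v) := by
  refine ⟨hu.memLp.sub hv.memLp, hu.memLp₁.sub hv.memLp₁, hu.memLp₂.sub hv.memLp₂, ?_⟩
  filter_upwards [hu.slice, hv.slice] with t h1 h2
  refine ⟨h1.1.sub h2.1, ?_⟩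
  filter_upwards [l2Fourier_sub h1.1 h2.1, h1.2, h2.2, l2Fourier_sub hu.memLp₁ hv.memLp₁,
    l2Fourier_sub hu.memLp₂ hv.memLp₂] with ξ e e1 e2 e3 e4
  change l2Fourier ((fun x => u (t, x)) - fun x => v (t, x)) ξ = _
  rw [e, Pi.sub_apply, e1, e2]
  simp only [waveSymbol, e3, e4, Pi.sub_apply]
  ring

theorem IsSpectralSolution.ae_eq_zero {f₁ f₂ : E n → ℂ} {u : ℝ × E n → ℂ}
    (hu : IsSpectralSolution T f₁ f₂ u) (h₁ : l2Fourier f₁ =ᵐ[volume] 0)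
    (h₂ : l2Fourier f₂ =ᵐ[volume] 0) : u =ᵐ[volume.restrict (slab n T)] 0 := by
  have hm := hu.memLp.1
  rw [volume_restrict_slab] at hm ⊢
  have hae : ∀ᵐ t ∂(volume.restrict (Ioo 0 T)), ∀ᵐ x, u (t, x) = 0 := by
    filter_upwards [hu.slice] with t ht
    refine l2Fourier_ae_eq_zero ht.1 ?_
    filter_upwards [ht.2, h₁, h₂] with ξ e e1 e2
    simp [e, waveSymbol, e1, e2]
  -- Fubini needs a measurable zero set to pass from slices to the slab, hence the strongly
  -- measurable representative.
  have hmk := hm.ae_eq_mk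
  have h3 : ∀ᵐ z ∂((volume.restrict (Ioo 0 T)).prod (volume : Measure (E n))), hm.mk u z = 0 := by
    rw [Measure.ae_prod_iff_ae_ae]
    · filter_upwards [hae, Measure.ae_ae_of_ae_prod hmk] with t h1 h2
      filter_upwards [h1, h2] with x h3 h4
      rw [← h4, h3]
    · exact hm.stronglyMeasurable_mk.measurable (measurableSet_singleton 0)
  filter_upwards [hmk, h3] with z h4 h5
  rw [h4, h5, Pi.zero_apply]

end

/-! ### Completeness of spherical harmonics -/

section

variable {n : ℕ}

theorem spherePoly_mono {d e : ℕ} (h : d ≤ e) : spherePoly n d ≤ spherePoly n e :=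
  Submodule.span_mono (image_mono fun _ hα => lt_of_lt_of_le hα h)

theorem spherePoly_zero : spherePoly n 0 = ⊥ := by simp [spherePoly]

/-- The monomial `θ ↦ θ^α` as a continuous function on the sphere. -/
def continuousMonomial (α : Fin n → ℕ) : C(S n, ℂ) :=
  ⟨fun θ : S n => ∏ i, (((θ : E n) i : ℝ) : ℂ) ^ α i, by fun_prop⟩

/-- Stone–Weierstrass: the coordinates separate points and are fixed by conjugation, so the star
algebra they generate is an ordinary algebra, contained in the span of the monomials. -/
theorem dense_span_continuousMonomial :
    Dense (Submodule.span ℂ (range (continuousMonomial (n := n))) : Set C(S n, ℂ)) := by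
  let c : Fin n → C(S n, ℂ) := fun i => ⟨fun θ : S n => (((θ : E n) i : ℝ) : ℂ), by fun_prop⟩
  let A : StarSubalgebra ℂ C(S n, ℂ) := StarAlgebra.adjoin ℂ (range c)
  have hstar : star (range c) = range c := by
    ext f
    simp only [Set.mem_star, mem_range]
    have hc : ∀ i, star (c i) = c i := fun i => by
      ext θ
      simp [c]
    refine exists_congr fun i => ?_
    rw [eq_comm, ← hc i, star_inj, hc i, eq_comm]
  have hA : A.topologicalClosure = ⊤ := by
    refine ContinuousMap.starSubalgebra_topologicalClosure_eq_top_of_separatesPoints A ?_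
    intro x y hxy
    obtain ⟨i, hi⟩ : ∃ i, (x : E n) i ≠ (y : E n) i := by
      by_contra! h
      exact hxy (Subtype.ext (PiLp.ext h))
    refine ⟨c i, ⟨c i, StarAlgebra.subset_adjoin ℂ _ (mem_range_self i), rfl⟩, ?_⟩
    simpa [c] using hi
  have hsub : (A : Set C(S n, ℂ)) ⊆ Submodule.span ℂ (range (continuousMonomial (n := n))) := by
    intro f hf
    have hf' : f ∈ A.toSubalgebra := hf
    rw [StarAlgebra.adjoin_toSubalgebra, hstar, union_self, ← Subalgebra.mem_toSubmodule,
      Algebra.adjoin_eq_span] at hf'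
    refine Submodule.span_mono (fun g hg => ?_) hf'
    induction hg using Submonoid.closure_induction with
    | mem g hg =>
      obtain ⟨i, rfl⟩ := hg
      refine ⟨Pi.single i 1, ?_⟩
      ext θ
      simp only [continuousMonomial, ContinuousMap.coe_mk, c]
      rw [Finset.prod_eq_single i] <;> simp +contextual
    | one => exact ⟨0, by ext θ; simp [continuousMonomial]⟩
    | mul f g _ _ hf hg =>
      obtain ⟨α, rfl⟩ := hf
      obtain ⟨β, rfl⟩ := hg
      exact ⟨α + β, by ext θ; simp [continuousMonomial, pow_add, Finset.prod_mul_distrib]⟩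
  have hd : Dense (A : Set C(S n, ℂ)) := by
    rw [dense_iff_closure_eq, ← StarSubalgebra.topologicalClosure_coe, hA]
    rfl
  exact hd.mono hsub

theorem topologicalClosure_iSup_spherePoly :
    (⨆ d, spherePoly n d).topologicalClosure = ⊤ := by
  rw [← Submodule.dense_iff_topologicalClosure_eq_top]
  have h1 : DenseRange (ContinuousMap.toLp (E := ℂ) 2 (sphereMeasure n) ℂ) :=
    ContinuousMap.toLp_denseRange ℂ (sphereMeasure n) ℂ (p := 2) ENNReal.ofNat_ne_top
  refine (h1.dense_image (ContinuousLinearMap.continuous _) dense_span_continuousMonomial).mono ?_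
  rintro _ ⟨f, hf, rfl⟩
  have : Submodule.span ℂ (range (continuousMonomial (n := n)))
      ≤ (⨆ d, spherePoly n d).comap
        (ContinuousMap.toLp (E := ℂ) 2 (sphereMeasure n) ℂ).toLinearMap := by
    rw [Submodule.span_le]
    rintro _ ⟨α, rfl⟩
    refine Submodule.mem_iSup_of_mem (∑ i, α i + 1) (Submodule.subset_span ⟨α, ?_, rfl⟩)
    exact Nat.lt_succ_self _
  exact this hf

/-- The orthonormal family of all chosen spherical harmonics. -/
noncomputable def harmonicFamily (n : ℕ) :
    (Σ ℓ : ℕ, Fin (Module.finrank ℂ (sphericalHarmonics n ℓ))) → Lp ℂ 2 (sphereMeasure n) :=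
  fun i => (stdOrthonormalBasis ℂ (sphericalHarmonics n i.1) i.2 : Lp ℂ 2 (sphereMeasure n))

theorem harmonicFamily_mem (i : Σ ℓ : ℕ, Fin (Module.finrank ℂ (sphericalHarmonics n ℓ))) :
    harmonicFamily n i ∈ sphericalHarmonics n i.1 := Subtype.coe_prop _

/-- For different degrees, the harmonic of lower degree lies in the polynomial space to which the
other is orthogonal by definition. -/
theorem orthonormal_harmonicFamily : Orthonormal ℂ (harmonicFamily n) := by
  have hlt : ∀ i j : (Σ ℓ : ℕ, Fin (Module.finrank ℂ (sphericalHarmonics n ℓ))), i.1 < j.1 →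
      inner ℂ (harmonicFamily n i) (harmonicFamily n j) = 0 := fun i j hij =>
    (harmonicFamily_mem j).2 _ (spherePoly_mono hij (harmonicFamily_mem i).1)
  refine ⟨fun i => (stdOrthonormalBasis ℂ (sphericalHarmonics n i.1)).orthonormal.1 i.2, ?_⟩
  rintro ⟨ℓ, i⟩ ⟨m, j⟩ hij
  rcases lt_trichotomy ℓ m with h | rfl | h
  · exact hlt _ _ h
  · refine (stdOrthonormalBasis ℂ (sphericalHarmonics n ℓ)).orthonormal.2 fun h => hij ?_
    exact congrArg (Sigma.mk ℓ) h
  · exact inner_eq_zero_symm.1 (hlt _ _ h)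

theorem sphericalHarmonics_le_span (ℓ : ℕ) :
    sphericalHarmonics n ℓ ≤ Submodule.span ℂ (range (harmonicFamily n)) := by
  intro g hg
  have h := (stdOrthonormalBasis ℂ (sphericalHarmonics n ℓ)).sum_repr ⟨g, hg⟩
  have h' := congrArg Subtype.val h
  simp only [Submodule.coe_sum, Submodule.coe_smul] at h'
  rw [← h']
  exact Submodule.sum_mem _ fun j _ => Submodule.smul_mem _ _
    (Submodule.subset_span ⟨⟨ℓ, j⟩, rfl⟩)

/-- Induction on the degree: subtracting from a polynomial of degree at most `d` its projection to
lower degrees leaves a harmonic of degree `d`. -/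
theorem spherePoly_le_span (d : ℕ) :
    spherePoly n d ≤ Submodule.span ℂ (range (harmonicFamily n)) := by
  induction d with
  | zero => simp [spherePoly_zero]
  | succ d ih =>
    intro p hp
    obtain ⟨a, ha, b, hb, rfl⟩ := (spherePoly n d).exists_add_mem_mem_orthogonal p
    refine Submodule.add_mem _ (ih ha) (sphericalHarmonics_le_span d ⟨?_, hb⟩)
    simpa using Submodule.sub_mem _ hp (spherePoly_mono d.le_succ ha)

/-- Parseval's identity for the expansion in spherical harmonics. -/
theorem tsum_sphericalHarmonics (g : Lp ℂ 2 (sphereMeasure n)) :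
    ∑' ℓ : ℕ, ∑ j : Fin (Module.finrank ℂ (sphericalHarmonics n ℓ)),
      ‖inner ℂ (stdOrthonormalBasis ℂ (sphericalHarmonics n ℓ) j : Lp ℂ 2 (sphereMeasure n)) g‖ₑ ^ 2
      = ‖g‖ₑ ^ 2 := by
  have hsp : ⊤ ≤ (Submodule.span ℂ (range (harmonicFamily n))).topologicalClosure := by
    rw [← topologicalClosure_iSup_spherePoly]
    exact Submodule.topologicalClosure_mono (iSup_le spherePoly_le_span)
  let b := HilbertBasis.mk orthonormal_harmonicFamily hsp
  have hb : ∀ i, b i = harmonicFamily n i := fun i => by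
    simp [b]
  have h := b.hasSum_inner_mul_inner g g
  have h2 : HasSum (fun i => ‖inner ℂ (b i) g‖ ^ 2) (‖g‖ ^ 2) := by
    have := Complex.hasSum_re h
    rw [inner_self_eq_norm_sq_to_K] at this
    convert this using 1
    · funext i
      rw [← inner_conj_symm, Complex.mul_conj, Complex.ofReal_re, RCLike.norm_conj,
        Complex.normSq_eq_norm_sq]
    · norm_cast
  have h3 : ∑' i, ‖inner ℂ (b i) g‖ₑ ^ 2 = ‖g‖ₑ ^ 2 := by
    rw [← ofReal_norm, ← ENNReal.ofReal_pow (norm_nonneg _), ← h2.tsum_eq,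
      ENNReal.ofReal_tsum_of_nonneg (fun _ => by positivity) h2.summable]
    refine tsum_congr fun i => ?_
    rw [← ofReal_norm, ← ENNReal.ofReal_pow (norm_nonneg _)]
  rw [← h3, ENNReal.tsum_sigma']
  refine tsum_congr fun ℓ => ?_
  rw [tsum_fintype]
  exact Finset.sum_congr rfl fun j _ => by rw [hb]; rfl

end

/-! ### The area of spherical caps -/

/-- A spherical cap of radius `ρ ≤ 1` has measure at least a constant times `ρ^(n-1)`. -/
theorem exists_le_sphereMeasure_closedBall (m : ℕ) :
    ∃ c : ℝ, 0 < c ∧ ∀ (p : S (m + 1)) (ρ : ℝ), 0 < ρ → ρ ≤ 1 →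
      ENNReal.ofReal (c * ρ ^ m) ≤ sphereMeasure (m + 1) (Metric.closedBall p ρ) := by
  refine ⟨1 / 4 * (1 / (8 * (m + 1))) ^ m, by positivity, fun p ρ hρ hρ1 => ?_⟩
  -- The area of a set on the sphere is the dimension times the volume of the cone over it. It is
  -- enough to fit a box, long in the direction `p` and thin across it, into the cone over the cap.
  obtain ⟨b, hb⟩ := Orthonormal.exists_orthonormalBasis_extension_of_card_eq (𝕜 := ℝ)
    (E := E (m + 1)) (ι := Fin (m + 1)) (by simp) (v := fun _ => (p : E (m + 1))) (s := {0})
    ⟨fun i => by simp, fun i j hij => absurd (Subsingleton.elim i j) hij⟩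
  have hb0 : b 0 = (p : E (m + 1)) := hb 0 rfl
  -- A point of the box is within `ρ/16` of the axis and has norm at least `3/16`, so normalising it
  -- moves it to within `2ρ/3` of `p`.
  set δ : ℝ := ρ / (16 * (m + 1)) with hδ
  have hδ0 : 0 < δ := by positivity
  let box : Set (Fin (m + 1) → ℝ) :=
    univ.pi (Fin.cons (Ioo (1 / 4) (1 / 2)) fun _ : Fin m => Icc (-δ) δ)
  have hboxm : MeasurableSet box := by
    refine MeasurableSet.univ_pi fun i => ?_
    refine Fin.cases ?_ (fun i => ?_) i
    · simp
    · simp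
  have hmp : MeasurePreserving (fun x : E (m + 1) => WithLp.ofLp (b.repr x)) volume volume :=
    (PiLp.volume_preserving_ofLp (Fin (m + 1))).comp b.measurePreserving_repr
  have hvol : volume ((fun x : E (m + 1) => WithLp.ofLp (b.repr x)) ⁻¹' box)
      = ENNReal.ofReal (1 / 4 * (1 / (8 * (m + 1))) ^ m * ρ ^ m) := by
    rw [hmp.measure_preimage hboxm.nullMeasurableSet, volume_pi_pi, Fin.prod_univ_succ]
    simp only [Fin.cons_zero, Fin.cons_succ, Real.volume_Ioo, Real.volume_Icc, Finset.prod_const,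
      Finset.card_univ, Fintype.card_fin]
    rw [← ENNReal.ofReal_pow (by linarith), ← ENNReal.ofReal_mul (by norm_num)]
    congr 1
    rw [mul_assoc, ← mul_pow]
    congr 1
    · norm_num
    · congr 1
      rw [hδ]
      field_simp
      ring
  have hsub : (fun x : E (m + 1) => WithLp.ofLp (b.repr x)) ⁻¹' box
      ⊆ Ioo (0 : ℝ) 1 • ((↑) '' Metric.closedBall p ρ : Set (E (m + 1))) := by
    intro x hx
    have hx0 : b.repr x 0 ∈ Ioo (1 / 4 : ℝ) (1 / 2) := by simpa using hx 0 (mem_univ _)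
    have hxs : ∀ i : Fin m, |b.repr x i.succ| ≤ δ := fun i => by
      have := hx i.succ (mem_univ _)
      simp only [Fin.cons_succ] at this
      exact abs_le.2 this
    set a := b.repr x 0
    have hsum := b.sum_repr x
    rw [Fin.sum_univ_succ, hb0] at hsum
    have hv : ‖x - a • (p : E (m + 1))‖ ≤ ρ / 16 := by
      rw [← hsum, add_sub_cancel_left]
      refine (norm_sum_le_of_le _ (f := fun i : Fin m => b.repr x i.succ • b i.succ)
        (n := fun _ => δ) fun i _ => ?_).trans ?_
      · rw [norm_smul, b.orthonormal.1, mul_one]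
        exact hxs i
      · rw [Finset.sum_const, Finset.card_univ, Fintype.card_fin, nsmul_eq_mul, hδ]
        rw [mul_div_assoc', div_le_div_iff₀ (by positivity) (by positivity)]
        nlinarith
    have hp : ‖(p : E (m + 1))‖ = 1 := by simp
    have hax : |‖x‖ - a| ≤ ρ / 16 := by
      have h1 := abs_norm_sub_norm_le x (a • (p : E (m + 1)))
      rw [norm_smul, hp, mul_one, Real.norm_of_nonneg (by linarith [hx0.1])] at h1
      exact h1.trans hv
    have hax' := abs_le.1 hax
    have hx1 : 0 < ‖x‖ := by linarith [hx0.1]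
    refine ⟨‖x‖, ⟨hx1, by linarith [hx0.2]⟩, ‖x‖⁻¹ • x, ⟨⟨‖x‖⁻¹ • x, ?_⟩, ?_, rfl⟩, ?_⟩
    · rw [mem_sphere_zero_iff_norm, norm_smul, norm_inv, norm_norm, inv_mul_cancel₀ hx1.ne']
    · rw [Metric.mem_closedBall, Subtype.dist_eq, dist_eq_norm]
      have e : ‖x‖⁻¹ • x - (p : E (m + 1))
          = ‖x‖⁻¹ • ((x - a • (p : E (m + 1))) + (a - ‖x‖) • (p : E (m + 1))) := by
        rw [sub_smul, ← add_sub_assoc, sub_add_cancel, smul_sub, smul_smul,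
          inv_mul_cancel₀ hx1.ne', one_smul]
      simp only [e]
      rw [norm_smul, norm_inv, norm_norm, inv_mul_le_iff₀ hx1]
      refine (norm_add_le _ _).trans ?_
      rw [norm_smul, hp, mul_one, Real.norm_eq_abs, abs_sub_comm]
      nlinarith [hx0.1]
    · simp [smul_smul, mul_inv_cancel₀ hx1.ne']
  rw [Measure.toSphere_apply' _ Metric.isClosed_closedBall.measurableSet, ← hvol]
  refine (measure_mono hsub).trans (le_mul_of_one_le_left zero_le ?_)
  simp

/-! ### Integrals of oscillations along light rays -/

section

/-- `|sin (l T)| / l` stays away from `T` for `l` bounded away from `0`. -/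
theorem exists_abs_sin_div_le {T ε : ℝ} (hT : 0 < T) (hε : 0 < ε) :
    ∃ δ : ℝ, 0 < δ ∧ ∀ l, ε ≤ l → |Real.sin (l * T)| / l ≤ T - δ := by
  -- For `lT ≤ 2` the sine is nonnegative, and `x - sin x` is at least its value at `q` for `x ≥ q`;
  -- for `lT ≥ 2` the trivial bound on the sine already gives `T/2`.
  set q := min (ε * T) 1 with hq
  have hq0 : 0 < q := by positivity
  have hκ : 0 < q - Real.sin q := sub_pos.2 (Real.sin_lt hq0)
  refine ⟨min ((q - Real.sin q) * T / 2) (T / 2), by positivity, fun l hl => ?_⟩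
  have hl0 : 0 < l := hε.trans_le hl
  rw [div_le_iff₀ hl0]
  rcases le_total (l * T) 2 with h | h
  · have hlT : 0 < l * T := by positivity
    have hqx : q ≤ l * T := (min_le_left _ _).trans (by gcongr)
    have hs0 : 0 ≤ Real.sin (l * T) :=
      Real.sin_nonneg_of_nonneg_of_le_pi hlT.le (by linarith [Real.pi_gt_three])
    have hlip : Real.sin (l * T) - Real.sin q ≤ l * T - q := by
      have := Real.abs_sin_sub_sin_le (l * T) q
      rw [abs_of_nonneg (sub_nonneg.2 hqx)] at this
      exact (le_abs_self _).trans this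
    rw [abs_of_nonneg hs0]
    have h1 : min ((q - Real.sin q) * T / 2) (T / 2) * l ≤ (q - Real.sin q) * T / 2 * l := by
      gcongr
      exact min_le_left _ _
    nlinarith
  · have h1 : min ((q - Real.sin q) * T / 2) (T / 2) * l ≤ T / 2 * l := by
      gcongr
      exact min_le_right _ _
    have := Real.abs_sin_le_one (l * T)
    nlinarith

theorem norm_integral_exp {T w : ℝ} (hT : 0 < T) (hw : w ≠ 0) :
    ‖∫ t in Ioo 0 T, Complex.exp (Complex.I * ((w * t : ℝ) : ℂ))‖
      = 2 * |Real.sin (w * T / 2)| / |w| := by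
  have hc : Complex.I * (w : ℂ) ≠ 0 := mul_ne_zero Complex.I_ne_zero (by exact_mod_cast hw)
  rw [← integral_Ioc_eq_integral_Ioo, ← intervalIntegral.integral_of_le hT.le]
  have h1 : ∀ t : ℝ, Complex.exp (Complex.I * ((w * t : ℝ) : ℂ))
      = Complex.exp (Complex.I * (w : ℂ) * (t : ℂ)) := fun t => by
    push_cast
    rw [mul_assoc]
  simp only [h1]
  rw [integral_exp_mul_complex hc, norm_div, ← h1 T]
  simp only [Complex.ofReal_zero, mul_zero, Complex.exp_zero]
  rw [Complex.norm_exp_I_mul_ofReal_sub_one]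
  simp

/-- The Fourier transform along light rays: `c` is the cosine of the angle between the frequency
and the direction of the ray. -/
noncomputable def rayIntegral (T l : ℝ) (a b : ℂ) (c : ℝ) : ℂ :=
  ∫ t in Ioo 0 T, (a * (Real.cos (l * t) : ℝ) + b * (t * Real.sinc (l * t) : ℝ)) *
    Complex.exp (Complex.I * ((l * t * c : ℝ) : ℂ))

section rayIntegral

variable {T l : ℝ} {a b : ℂ}

/-- Euler's formula. The amplitudes of the two exponentials, called `A` and `B` below, replace `a`
and `b` in all estimates. -/
theorem cos_add_sinc_eq (hl : l ≠ 0) (t : ℝ) :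
    a * (Real.cos (l * t) : ℝ) + b * (t * Real.sinc (l * t) : ℝ)
      = (a - Complex.I * (b / l)) / 2 * Complex.exp (Complex.I * ((l * t : ℝ) : ℂ))
        + (a + Complex.I * (b / l)) / 2 * Complex.exp (-(Complex.I * ((l * t : ℝ) : ℂ))) := by
  have hl' : (l : ℂ) ≠ 0 := by exact_mod_cast hl
  have h1 : ((t * Real.sinc (l * t) : ℝ) : ℂ) = (Real.sin (l * t) : ℝ) / (l : ℂ) := by
    rw [← mul_mul_sinc, Complex.ofReal_mul l, mul_div_cancel_left₀ _ hl']
  rw [h1, Complex.ofReal_cos, Complex.ofReal_sin, mul_comm Complex.I ((l * t : ℝ) : ℂ),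
    ← neg_mul, Complex.exp_mul_I, Complex.exp_mul_I, Complex.cos_neg, Complex.sin_neg]
  linear_combination ((b / l) * Complex.sin ((l * t : ℝ) : ℂ)) * Complex.I_sq

/-- The phases for `c` and `d` differ by at most `l T |c - d|`, the oscillation is bounded by `‖A‖ +
‖B‖`, and the interval has length `T`. -/
theorem norm_rayIntegral_sub_le (hl : 0 < l) (hT : 0 < T) {A B : ℂ}
    (hA : A = (a - Complex.I * (b / l)) / 2) (hB : B = (a + Complex.I * (b / l)) / 2) (c d : ℝ) :
    ‖rayIntegral T l a b c - rayIntegral T l a b d‖ ≤ l * T ^ 2 * |c - d| * (‖A‖ + ‖B‖) := by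
  have hcont : ∀ c : ℝ, IntegrableOn (fun t : ℝ =>
      (a * (Real.cos (l * t) : ℝ) + b * (t * Real.sinc (l * t) : ℝ)) *
        Complex.exp (Complex.I * ((l * t * c : ℝ) : ℂ))) (Ioo 0 T) := fun c => by
    refine (ContinuousOn.integrableOn_Icc (a := 0) (b := T) ?_).mono_set Ioo_subset_Icc_self
    have := Real.continuous_sinc
    fun_prop
  unfold rayIntegral
  rw [← integral_sub (hcont c) (hcont d)]
  have hbd : ∀ t ∈ Ioo 0 T, ‖(a * (Real.cos (l * t) : ℝ) + b * (t * Real.sinc (l * t) : ℝ)) *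
        Complex.exp (Complex.I * ((l * t * c : ℝ) : ℂ))
      - (a * (Real.cos (l * t) : ℝ) + b * (t * Real.sinc (l * t) : ℝ)) *
        Complex.exp (Complex.I * ((l * t * d : ℝ) : ℂ))‖ ≤ (‖A‖ + ‖B‖) * (l * T * |c - d|) := by
    intro t ht
    rw [← mul_sub, norm_mul]
    gcongr
    · rw [cos_add_sinc_eq hl.ne', ← hA, ← hB, ← mul_neg, ← Complex.ofReal_neg]
      refine (norm_add_le _ _).trans ?_
      rw [norm_mul, norm_mul, mul_comm Complex.I, mul_comm Complex.I,
        Complex.norm_exp_ofReal_mul_I, Complex.norm_exp_ofReal_mul_I, mul_one, mul_one]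
    · have e : Complex.exp (Complex.I * ((l * t * c : ℝ) : ℂ))
            - Complex.exp (Complex.I * ((l * t * d : ℝ) : ℂ))
          = Complex.exp (((l * t * d : ℝ) : ℂ) * Complex.I) *
            (Complex.exp (Complex.I * ((l * t * (c - d) : ℝ) : ℂ)) - 1) := by
        rw [mul_sub, mul_one, ← Complex.exp_add, mul_comm _ Complex.I, ← mul_add,
          ← Complex.ofReal_add]
        congr 4
        ring
      rw [e, norm_mul, Complex.norm_exp_ofReal_mul_I, one_mul]
      refine Real.norm_exp_I_mul_ofReal_sub_one_le.trans ?_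
      rw [Real.norm_eq_abs, abs_mul, abs_of_pos (mul_pos hl ht.1)]
      gcongr
      exact ht.2.le
  refine (norm_setIntegral_le_of_norm_le_const (by simp) hbd).trans_eq ?_
  rw [measureReal_def, Real.volume_Ioo, sub_zero, ENNReal.toReal_ofReal hT.le]
  ring

/-- At `c = 1` the phase cancels the exponential of amplitude `B`, which contributes `B T`; the
other has frequency `2l` and its integral has modulus `|sin(lT)|/l ≤ T - δ`. At `c = -1` the roles
are exchanged, and in the sum each amplitude keeps `T - (T - δ) = δ`. -/
theorem le_norm_rayIntegral_add (hl : 0 < l) (hT : 0 < T) {A B : ℂ}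
    (hA : A = (a - Complex.I * (b / l)) / 2) (hB : B = (a + Complex.I * (b / l)) / 2) {δ : ℝ}
    (hδ : |Real.sin (l * T)| / l ≤ T - δ) :
    δ * (‖A‖ + ‖B‖) ≤ ‖rayIntegral T l a b 1‖ + ‖rayIntegral T l a b (-1)‖ := by
  have hint : ∀ w : ℝ, IntegrableOn (fun t : ℝ => Complex.exp (Complex.I * ((w * t : ℝ) : ℂ)))
      (Ioo 0 T) := fun w => by
    refine (ContinuousOn.integrableOn_Icc (a := 0) (b := T) ?_).mono_set Ioo_subset_Icc_self
    fun_prop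
  have hone : ∫ t in Ioo 0 T, (1 : ℂ) = T := by
    simp [measureReal_def, hT.le]
  have hconst : IntegrableOn (fun _ : ℝ => (1 : ℂ)) (Ioo 0 T) := by simp
  have e1 : rayIntegral T l a b 1
      = A * (∫ t in Ioo 0 T, Complex.exp (Complex.I * ((2 * l * t : ℝ) : ℂ))) + B * T := by
    rw [← hone, ← integral_const_mul, ← integral_const_mul,
      ← integral_add ((hint (2 * l)).const_mul A) (hconst.const_mul B)]
    refine integral_congr_ae (.of_forall fun t => ?_)
    simp only
    rw [cos_add_sinc_eq hl.ne', ← hA, ← hB, add_mul, mul_assoc A, mul_assoc B, ← Complex.exp_add,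
      ← Complex.exp_add]
    congr 2
    · congr 1
      push_cast
      ring
    · rw [mul_one, neg_add_cancel, Complex.exp_zero]
  have e2 : rayIntegral T l a b (-1)
      = A * T + B * (∫ t in Ioo 0 T, Complex.exp (Complex.I * ((-(2 * l) * t : ℝ) : ℂ))) := by
    rw [← hone, ← integral_const_mul, ← integral_const_mul,
      ← integral_add (hconst.const_mul A) ((hint (-(2 * l))).const_mul B)]
    refine integral_congr_ae (.of_forall fun t => ?_)
    simp only
    rw [cos_add_sinc_eq hl.ne', ← hA, ← hB, add_mul, mul_assoc A, mul_assoc B, ← Complex.exp_add,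
      ← Complex.exp_add]
    congr 2
    · rw [mul_neg_one, Complex.ofReal_neg, mul_neg, add_neg_cancel, Complex.exp_zero]
    · congr 1
      push_cast
      ring
  have n1 : ‖∫ t in Ioo 0 T, Complex.exp (Complex.I * ((2 * l * t : ℝ) : ℂ))‖ ≤ T - δ := by
    rw [norm_integral_exp hT (by positivity), abs_of_pos (show 0 < 2 * l by positivity)]
    refine le_trans (le_of_eq ?_) hδ
    rw [show 2 * l * T / 2 = l * T by ring]
    field_simp
  have n2 : ‖∫ t in Ioo 0 T, Complex.exp (Complex.I * ((-(2 * l) * t : ℝ) : ℂ))‖ ≤ T - δ := by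
    rw [norm_integral_exp hT (neg_ne_zero.2 (by positivity)), abs_neg,
      abs_of_pos (show 0 < 2 * l by positivity)]
    refine le_trans (le_of_eq ?_) hδ
    rw [show -(2 * l) * T / 2 = -(l * T) by ring, Real.sin_neg, abs_neg]
    field_simp
  have m1 : ‖B‖ * T - ‖A‖ * (T - δ) ≤ ‖rayIntegral T l a b 1‖ := by
    rw [e1, add_comm]
    refine le_trans ?_ (norm_sub_le_norm_add _ _)
    rw [norm_mul, norm_mul, Complex.norm_real, Real.norm_of_nonneg hT.le]
    gcongr
  have m2 : ‖A‖ * T - ‖B‖ * (T - δ) ≤ ‖rayIntegral T l a b (-1)‖ := by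
    rw [e2]
    refine le_trans ?_ (norm_sub_le_norm_add _ _)
    rw [norm_mul, norm_mul, Complex.norm_real, Real.norm_of_nonneg hT.le]
    gcongr
  linarith

end rayIntegral

end

/-! ### Lower bound averaged over directions -/

theorem parallelogram_complex (a d : ℂ) :
    ‖a‖ ^ 2 + ‖d‖ ^ 2
      = 2 * (‖(a - Complex.I * d) / 2‖ ^ 2 + ‖(a + Complex.I * d) / 2‖ ^ 2) := by
  have h := parallelogram_law_with_norm ℝ a (Complex.I * d)
  rw [norm_mul, Complex.norm_I, one_mul] at h
  rw [norm_div, norm_div, Complex.norm_ofNat]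
  nlinarith

/-- The cap radius is of order `X^{-1/4}`, so its area costs `X^{-m/4}`, while the data carry one
factor `X`. The exponents match since `1 + m/4 ≤ (m+1)/2` exactly when `m ≥ 2`. -/
theorem rpow_cap_le {m : ℕ} (hm : 2 ≤ m) {X κ : ℝ} (hX : 1 ≤ X) (hκ : 0 < κ) :
    X * Real.sqrt κ ^ m ≤ X ^ (((m + 1 : ℕ) : ℝ) / 2) * Real.sqrt (κ / Real.sqrt X) ^ m := by
  have hX0 : 0 < X := by linarith
  rw [Real.sqrt_div hκ.le, div_pow, mul_div_assoc', le_div_iff₀ (by positivity)]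
  have h1 : Real.sqrt (Real.sqrt X) ^ m = X ^ ((m : ℝ) / 4) := by
    rw [Real.sqrt_eq_rpow, Real.sqrt_eq_rpow, ← Real.rpow_mul hX0.le, ← Real.rpow_natCast,
      ← Real.rpow_mul hX0.le]
    congr 1
    ring
  have h2 : X * X ^ ((m : ℝ) / 4) ≤ X ^ (((m + 1 : ℕ) : ℝ) / 2) := by
    nth_rewrite 1 [← Real.rpow_one X]
    rw [← Real.rpow_add hX0]
    refine Real.rpow_le_rpow_of_exponent_le hX ?_
    have : (2 : ℝ) ≤ m := by exact_mod_cast hm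
    push_cast
    linarith
  rw [h1]
  calc X * Real.sqrt κ ^ m * X ^ ((m : ℝ) / 4) = X * X ^ ((m : ℝ) / 4) * Real.sqrt κ ^ m := by ring
    _ ≤ _ := by gcongr

/-- For frequencies bounded away from `0`, the Cauchy data are controlled by the Fourier transform
of the light ray transform, averaged over all directions. -/
theorem exists_le_lintegral_rayIntegral {n : ℕ} (hn : 3 ≤ n) {T ε : ℝ} (hT : 0 < T) (hε : 0 < ε) :
    ∃ c : ℝ, 0 < c ∧ ∀ ξ : E n, ε ≤ freq ξ → ∀ a b : ℂ,
      ENNReal.ofReal (c * ((1 + freq ξ ^ 2) * ‖a‖ ^ 2 + ‖b‖ ^ 2)) ≤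
        ENNReal.ofReal ((1 + freq ξ ^ 2) ^ ((n : ℝ) / 2)) *
          ∫⁻ θ : S n, ‖rayIntegral T (freq ξ) a b (inner ℝ (‖ξ‖⁻¹ • ξ) (θ : E n))‖ₑ ^ 2
            ∂(sphereMeasure n) := by
  obtain ⟨m, rfl⟩ : ∃ m, n = m + 1 := ⟨n - 1, by omega⟩
  obtain ⟨c₀, hc₀, hcap⟩ := exists_le_sphereMeasure_closedBall m
  obtain ⟨δ, hδ, hsin⟩ := exists_abs_sin_div_le hT hε
  -- Small enough that the variation over the cap is at most half of the lower bound at its centre;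
  -- the minimum with `1` keeps the cap radius at most `1`.
  set κ : ℝ := min 1 (δ / (2 * T ^ 2)) with hκ
  have hκ0 : 0 < κ := by positivity
  refine ⟨(δ / 4) ^ 2 * c₀ * Real.sqrt κ ^ m / 2, by positivity, fun ξ hξ a b => ?_⟩
  set l := freq ξ with hl
  have hl0 : 0 < l := hε.trans_le hξ
  have hξ0 : 0 < ‖ξ‖ := by
    have : 0 < 2 * Real.pi * ‖ξ‖ := hl0
    exact pos_of_mul_pos_right this (by positivity)
  set X := 1 + l ^ 2 with hX
  have hX1 : 1 ≤ X := by rw [hX]; nlinarith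
  set A := (a - Complex.I * (b / l)) / 2 with hA
  set B := (a + Complex.I * (b / l)) / 2 with hB
  set N := ‖A‖ + ‖B‖ with hN
  set ρ := Real.sqrt (κ / Real.sqrt X) with hρ
  have hρ0 : 0 < ρ := by positivity
  have hκX : κ / Real.sqrt X ≤ 1 := by
    rw [div_le_one (by positivity)]
    exact (min_le_left _ _).trans (Real.one_le_sqrt.2 hX1)
  have hρ1 : ρ ≤ 1 := Real.sqrt_le_one.2 hκX
  have hρ2 : ρ ^ 2 = κ / Real.sqrt X := Real.sq_sqrt (by positivity)
  have hlX : l ≤ Real.sqrt X := Real.le_sqrt_of_sq_le (by rw [hX]; linarith)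
  have hlρ : l * ρ ^ 2 ≤ κ := by
    rw [hρ2, mul_div_assoc', div_le_iff₀ (by positivity), mul_comm]
    gcongr
  let e : S (m + 1) := ⟨‖ξ‖⁻¹ • ξ, by
    rw [mem_sphere_zero_iff_norm, norm_smul, norm_inv, norm_norm, inv_mul_cancel₀ hξ0.ne']⟩
  have he : (e : E (m + 1)) = ‖ξ‖⁻¹ • ξ := rfl
  have hen : ‖(e : E (m + 1))‖ = 1 := by simp
  -- One of the two poles `±ξ/‖ξ‖` carries at least half of the lower bound; which one depends on
  -- `a` and `b`.
  obtain ⟨σ, p, hσ, hp, hJ⟩ : ∃ (σ : ℝ) (p : S (m + 1)), |σ| = 1 ∧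
      (p : E (m + 1)) = σ • (e : E (m + 1)) ∧ δ / 2 * N ≤ ‖rayIntegral T l a b σ‖ := by
    have h := le_norm_rayIntegral_add hl0 hT hA hB (hsin l hξ)
    rcases le_total (δ / 2 * N) ‖rayIntegral T l a b 1‖ with h1 | h1
    · exact ⟨1, e, by simp, by simp, h1⟩
    · exact ⟨-1, -e, by simp, by simp, by linarith⟩
  have hσ2 : σ * σ = 1 := by rw [← abs_mul_abs_self, hσ, one_mul]
  have hlow : ∀ θ ∈ Metric.closedBall p ρ,
      ENNReal.ofReal ((δ / 4 * N) ^ 2) ≤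
        ‖rayIntegral T l a b (inner ℝ (‖ξ‖⁻¹ • ξ) (θ : E (m + 1)))‖ₑ ^ 2 := by
    intro θ hθ
    rw [Metric.mem_closedBall, Subtype.dist_eq, dist_eq_norm] at hθ
    have hθn : ‖(θ : E (m + 1))‖ = 1 := by simp
    have hpn : ‖(p : E (m + 1))‖ = 1 := by simp
    -- The cosine deviates from its value at the pole by the square of the distance, which permits a
    -- radius of order `l^{-1/2}` instead of `l^{-1}`.
    have hin : inner ℝ (e : E (m + 1)) (θ : E (m + 1)) - σ
        = -σ * (‖(θ : E (m + 1)) - (p : E (m + 1))‖ ^ 2 / 2) := by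
      rw [norm_sub_sq_real, hθn, hpn, hp, inner_smul_right,
        real_inner_comm (e : E (m + 1)) (θ : E (m + 1))]
      linear_combination (-inner ℝ (e : E (m + 1)) (θ : E (m + 1))) * hσ2
    have habs : |inner ℝ (e : E (m + 1)) (θ : E (m + 1)) - σ| ≤ ρ ^ 2 / 2 := by
      rw [hin, abs_mul, abs_neg, hσ, one_mul, abs_of_nonneg (by positivity)]
      gcongr
    have hlip := norm_rayIntegral_sub_le (T := T) hl0 hT hA hB
      (inner ℝ (e : E (m + 1)) (θ : E (m + 1))) σ
    have hsmall : l * T ^ 2 * |inner ℝ (e : E (m + 1)) (θ : E (m + 1)) - σ| ≤ δ / 4 := by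
      have hκT : κ * T ^ 2 ≤ δ / 2 := by
        have := min_le_right 1 (δ / (2 * T ^ 2))
        rw [← hκ, le_div_iff₀ (by positivity)] at this
        linarith
      calc l * T ^ 2 * |inner ℝ (e : E (m + 1)) (θ : E (m + 1)) - σ|
          ≤ l * T ^ 2 * (ρ ^ 2 / 2) := by gcongr
        _ = (l * ρ ^ 2) * T ^ 2 / 2 := by ring
        _ ≤ κ * T ^ 2 / 2 := by gcongr
        _ ≤ δ / 4 := by linarith
    have hN0 : 0 ≤ N := by positivity
    have hfin : δ / 4 * N ≤ ‖rayIntegral T l a b (inner ℝ (‖ξ‖⁻¹ • ξ) (θ : E (m + 1)))‖ := by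
      rw [← he]
      have h1 := norm_sub_norm_le (rayIntegral T l a b σ)
        (rayIntegral T l a b (inner ℝ (e : E (m + 1)) (θ : E (m + 1))))
      rw [norm_sub_rev] at h1
      have h2 := mul_le_mul_of_nonneg_right hsmall hN0
      linarith
    rw [← ofReal_norm, ← ENNReal.ofReal_pow (norm_nonneg _)]
    gcongr
  have hint : ENNReal.ofReal ((δ / 4 * N) ^ 2) * ENNReal.ofReal (c₀ * ρ ^ m) ≤
      ∫⁻ θ : S (m + 1), ‖rayIntegral T l a b (inner ℝ (‖ξ‖⁻¹ • ξ) (θ : E (m + 1)))‖ₑ ^ 2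
        ∂(sphereMeasure (m + 1)) := by
    calc _ ≤ ENNReal.ofReal ((δ / 4 * N) ^ 2) * sphereMeasure (m + 1) (Metric.closedBall p ρ) := by
          gcongr
          exact hcap p ρ hρ0 hρ1
      _ = ∫⁻ _ in Metric.closedBall p ρ, ENNReal.ofReal ((δ / 4 * N) ^ 2)
            ∂(sphereMeasure (m + 1)) := (setLIntegral_const _ _).symm
      _ ≤ ∫⁻ θ in Metric.closedBall p ρ,
            ‖rayIntegral T l a b (inner ℝ (‖ξ‖⁻¹ • ξ) (θ : E (m + 1)))‖ₑ ^ 2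
            ∂(sphereMeasure (m + 1)) :=
          setLIntegral_mono' Metric.isClosed_closedBall.measurableSet hlow
      _ ≤ _ := setLIntegral_le_lintegral _ _
  refine le_trans ?_ (mul_le_mul_right hint _)
  rw [← ENNReal.ofReal_mul (by positivity), ← ENNReal.ofReal_mul (by positivity)]
  refine ENNReal.ofReal_le_ofReal ?_
  have hpow := rpow_cap_le (by omega : 2 ≤ m) hX1 hκ0
  have hdata : X * ‖a‖ ^ 2 + ‖b‖ ^ 2 ≤ 2 * X * N ^ 2 := by
    have h1 := parallelogram_complex a (b / l)
    have h2 : ‖b‖ ^ 2 ≤ X * ‖b / l‖ ^ 2 := by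
      rw [norm_div, Complex.norm_real, Real.norm_of_nonneg hl0.le, div_pow, mul_div_assoc',
        le_div_iff₀ (by positivity), mul_comm]
      gcongr
      rw [hX]
      linarith
    have h3 : ‖A‖ ^ 2 + ‖B‖ ^ 2 ≤ N ^ 2 := by
      rw [hN, add_sq]
      have : 0 ≤ 2 * ‖A‖ * ‖B‖ := by positivity
      linarith
    rw [← hA, ← hB] at h1
    calc X * ‖a‖ ^ 2 + ‖b‖ ^ 2 ≤ X * (‖a‖ ^ 2 + ‖b / l‖ ^ 2) := by linarith
      _ = 2 * X * (‖A‖ ^ 2 + ‖B‖ ^ 2) := by rw [h1]; ring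
      _ ≤ _ := by gcongr
  calc (δ / 4) ^ 2 * c₀ * Real.sqrt κ ^ m / 2 * (X * ‖a‖ ^ 2 + ‖b‖ ^ 2)
      ≤ (δ / 4) ^ 2 * c₀ * Real.sqrt κ ^ m / 2 * (2 * X * N ^ 2) := by gcongr
    _ = (δ / 4 * N) ^ 2 * c₀ * (X * Real.sqrt κ ^ m) := by ring
    _ ≤ (δ / 4 * N) ^ 2 * c₀ * (X ^ (((m + 1 : ℕ) : ℝ) / 2) * ρ ^ m) := by gcongr
    _ = _ := by ring

/-! ### Square integrability of ray data, and Fubini for rays -/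

section

variable {n : ℕ} {T : ℝ}

instance (n : ℕ) : SFinite (cylMeasure n) := Measure.prod.instSFinite

instance (n : ℕ) : SFinite ((sphereMeasure n).prod (volume : Measure (E n))) :=
  Measure.prod.instSFinite

/-- The measure `dr dθ dy` on `(0, T) × 𝕊ⁿ⁻¹ × ℝⁿ`. -/
noncomputable abbrev rayMeasure (n : ℕ) (T : ℝ) : Measure ((ℝ × S n) × E n) :=
  (((volume : Measure ℝ).restrict (Ioo 0 T)).prod (sphereMeasure n)).prod volume

theorem measurePreserving_forgetDirection (n : ℕ) (T : ℝ) :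
    MeasurePreserving (fun p : (ℝ × S n) × E n => ((p.1.1, p.2), p.1.2)) (rayMeasure n T)
      ((((volume : Measure ℝ).restrict (Ioo 0 T)).prod (volume : Measure (E n))).prod
        (sphereMeasure n)) := by
  have h1 := measurePreserving_prodAssoc ((volume : Measure ℝ).restrict (Ioo 0 T))
    (sphereMeasure n) (volume : Measure (E n))
  have h2 : MeasurePreserving (Prod.map id Prod.swap : ℝ × (S n × E n) → ℝ × (E n × S n))
      (((volume : Measure ℝ).restrict (Ioo 0 T)).prod
        ((sphereMeasure n).prod (volume : Measure (E n))))
      (((volume : Measure ℝ).restrict (Ioo 0 T)).prod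
        ((volume : Measure (E n)).prod (sphereMeasure n))) :=
    (MeasurePreserving.id _).prod (Measure.measurePreserving_swap
      (μ := sphereMeasure n) (ν := (volume : Measure (E n))))
  have h3 := (measurePreserving_prodAssoc ((volume : Measure ℝ).restrict (Ioo 0 T))
    (volume : Measure (E n)) (sphereMeasure n)).symm
  exact (h3.comp h2).comp h1

/-- A skew product whose fibre maps are translations. It makes `u(r, y + rθ)` square integrable in
all its variables, independently of the representative of `u`. -/
theorem measurePreserving_shear (n : ℕ) (T : ℝ) :
    MeasurePreserving (fun p : (ℝ × S n) × E n => (p.1, p.2 + p.1.1 • (p.1.2 : E n)))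
      (rayMeasure n T) (rayMeasure n T) := by
  refine (MeasurePreserving.id _).skew_product (g := fun q : ℝ × S n => fun y : E n =>
    y + q.1 • (q.2 : E n)) ?_ (.of_forall fun q => ?_)
  · exact Continuous.measurable (by fun_prop)
  · exact map_add_right_eq_self volume _

theorem memLp_ray {w : ℝ × E n → ℂ} (hw : MemLp w 2 (volume.restrict (slab n T))) :
    MemLp (fun p : (ℝ × S n) × E n => w (p.1.1, p.2)) 2 (rayMeasure n T) := by
  rw [volume_restrict_slab] at hw
  exact (hw.comp_fst (sphereMeasure n)).comp_measurePreserving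
    (measurePreserving_forgetDirection n T)

theorem memLp_ray_shear {w : ℝ × E n → ℂ} (hw : MemLp w 2 (volume.restrict (slab n T))) :
    MemLp (fun p : (ℝ × S n) × E n => w (p.1.1, p.2 + p.1.1 • (p.1.2 : E n))) 2
      (rayMeasure n T) :=
  (memLp_ray hw).comp_measurePreserving (measurePreserving_shear n T)

theorem memLp_conj {α : Type*} [MeasurableSpace α] {μ : Measure α} {f : α → ℂ}
    (hf : MemLp f 2 μ) : MemLp (fun a => (starRingEnd ℂ) (f a)) 2 μ :=
  hf.star

theorem memLp_mul_prod {α β : Type*} [MeasurableSpace α] [MeasurableSpace β] {μ : Measure α}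
    {ν : Measure β} [SFinite μ] [SFinite ν] {f : α → ℂ} {g : β → ℂ} (hf : MemLp f 2 μ)
    (hg : MemLp g 2 ν) : MemLp (fun p : α × β => f p.1 * g p.2) 2 (μ.prod ν) := by
  have hm : AEStronglyMeasurable (fun p : α × β => f p.1 * g p.2) (μ.prod ν) :=
    hf.1.comp_fst.mul hg.1.comp_snd
  rw [memLp_two_iff_integrable_sq_norm hm]
  refine (((memLp_two_iff_integrable_sq_norm hf.1).1 hf).mul_prod
    ((memLp_two_iff_integrable_sq_norm hg.1).1 hg)).congr (.of_forall fun p => ?_)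
  simp only [norm_mul, mul_pow]

theorem memLp_direction_mul (Y : Lp ℂ 2 (sphereMeasure n)) {g : E n → ℂ}
    (hg : MemLp g 2 volume) :
    MemLp (fun p : (ℝ × S n) × E n => (starRingEnd ℂ) (Y p.1.2) * g p.2) 2 (rayMeasure n T) :=
  memLp_mul_prod (f := fun q : ℝ × S n => (starRingEnd ℂ) (Y q.2))
    ((memLp_conj (Lp.memLp Y)).comp_snd _) hg

theorem integral_rayMeasure {Ψ : (ℝ × S n) × E n → ℂ} (hΨ : Integrable Ψ (rayMeasure n T)) :
    ∫ p, Ψ p ∂(rayMeasure n T)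
      = ∫ y : E n, (∫ θ : S n, (∫ r : ℝ in Ioo 0 T, Ψ ((r, θ), y)) ∂(sphereMeasure n)) := by
  rw [integral_prod_symm _ hΨ]
  refine integral_congr_ae ?_
  filter_upwards [hΨ.prod_left_ae] with y hy
  exact integral_prod_symm _ hy

theorem lightRaySlab_apply (u : ℝ × E n → ℂ) (y : E n) (θ : S n) :
    lightRaySlab T u (y, θ) = ∫ r in Ioo 0 T, u (r, y + r • (θ : E n)) := by
  rw [lightRaySlab, lightRay, ← integral_indicator measurableSet_Ioo]
  refine integral_congr_ae (.of_forall fun r => ?_)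
  by_cases hr : r ∈ Ioo 0 T
  · have : (r, y + r • (θ : E n)) ∈ slab n T := ⟨hr, mem_univ _⟩
    simp [hr, this]
  · have : (r, y + r • (θ : E n)) ∉ slab n T := fun h => hr h.1
    simp [hr, this]

/-- Cauchy–Schwarz in each fibre. It serves both for coefficients against spherical harmonics and,
with `g = 1` on `(0, T)`, for integration along rays. -/
theorem memLp_integral_mul_conj {α β : Type*} [MeasurableSpace α] [MeasurableSpace β]
    {μ : Measure α} {ν : Measure β} [SFinite μ] [SFinite ν] {F : β × α → ℂ}
    (hF : MemLp F 2 (ν.prod μ)) (g : Lp ℂ 2 μ) :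
    MemLp (fun y => ∫ a, F (y, a) * (starRingEnd ℂ) (g a) ∂μ) 2 ν := by
  have hm : AEStronglyMeasurable (fun y => ∫ a, F (y, a) * (starRingEnd ℂ) (g a) ∂μ) ν :=
    (hF.1.mul (memLp_conj (Lp.memLp g)).1.comp_snd).integral_prod_right'
  have hsq := (memLp_two_iff_integrable_sq_norm hF.1).1 hF
  have hi : Integrable (fun y => ‖g‖ ^ 2 * ∫ a, ‖F (y, a)‖ ^ 2 ∂μ) ν :=
    hsq.integral_prod_left.const_mul _
  rw [memLp_two_iff_integrable_sq_norm hm]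
  refine hi.mono' (hm.norm.pow 2) ?_
  filter_upwards [hF.1.prodMk_left, hsq.prod_right_ae] with y h1 h2
  have hy : MemLp (fun a => F (y, a)) 2 μ := (memLp_two_iff_integrable_sq_norm h1).2 h2
  have e : ∫ a, F (y, a) * (starRingEnd ℂ) (g a) ∂μ = inner ℂ g (hy.toLp _) := by
    rw [L2.inner_def]
    refine integral_congr_ae ?_
    filter_upwards [hy.coeFn_toLp] with a ha
    rw [ha]
    simp
  have e2 : ‖hy.toLp _‖ ^ 2 = ∫ a, ‖F (y, a)‖ ^ 2 ∂μ := by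
    rw [← inner_self_eq_norm_sq (𝕜 := ℂ), L2.inner_def,
      ← integral_re (L2.integrable_inner _ _)]
    refine integral_congr_ae ?_
    filter_upwards [hy.coeFn_toLp] with a ha
    rw [ha, inner_self_eq_norm_sq]
  rw [Real.norm_of_nonneg (by positivity), ← e2, ← mul_pow, e]
  gcongr
  exact norm_inner_le_norm _ _

theorem memLp_sphereCoeff {F : E n × S n → ℂ} (hF : MemLp F 2 (cylMeasure n))
    (Y : Lp ℂ 2 (sphereMeasure n)) : MemLp (sphereCoeff F Y) 2 volume :=
  memLp_integral_mul_conj hF Y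

theorem measurePreserving_rayParameter (n : ℕ) (T : ℝ) :
    MeasurePreserving (fun p : (E n × S n) × ℝ => ((p.2, p.1.2), p.1.1))
      ((cylMeasure n).prod ((volume : Measure ℝ).restrict (Ioo 0 T))) (rayMeasure n T) := by
  have h1 := (measurePreserving_prodAssoc ((volume : Measure ℝ).restrict (Ioo 0 T))
    (sphereMeasure n) (volume : Measure (E n))).symm
  have h2 : MeasurePreserving (Prod.map id Prod.swap : ℝ × (E n × S n) → ℝ × (S n × E n))
      (((volume : Measure ℝ).restrict (Ioo 0 T)).prod
        ((volume : Measure (E n)).prod (sphereMeasure n)))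
      (((volume : Measure ℝ).restrict (Ioo 0 T)).prod
        ((sphereMeasure n).prod (volume : Measure (E n)))) :=
    (MeasurePreserving.id _).prod (Measure.measurePreserving_swap
      (μ := (volume : Measure (E n))) (ν := sphereMeasure n))
  exact (h1.comp h2).comp (Measure.measurePreserving_swap (μ := cylMeasure n))

theorem memLp_integral_ray {W : (ℝ × S n) × E n → ℂ} (hW : MemLp W 2 (rayMeasure n T)) :
    MemLp (fun p : E n × S n => ∫ r in Ioo 0 T, W ((r, p.2), p.1)) 2 (cylMeasure n) := by
  have h1 : MemLp (fun _ : ℝ => (1 : ℂ)) 2 ((volume : Measure ℝ).restrict (Ioo 0 T)) :=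
    memLp_const 1
  have h := memLp_integral_mul_conj
    (hW.comp_measurePreserving (measurePreserving_rayParameter n T)) (h1.toLp _)
  refine h.ae_eq (.of_forall fun p => integral_congr_ae ?_)
  filter_upwards [h1.coeFn_toLp] with r hr
  rw [hr, map_one, mul_one]
  rfl

theorem integral_ray_mul {W : (ℝ × S n) × E n → ℂ} (hW : MemLp W 2 (rayMeasure n T))
    (Y : Lp ℂ 2 (sphereMeasure n)) {g : E n → ℂ} (hg : MemLp g 2 volume) :
    ∫ p, W p * ((starRingEnd ℂ) (Y p.1.2) * g p.2) ∂(rayMeasure n T)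
      = ∫ y, sphereCoeff (fun q : E n × S n => ∫ r in Ioo 0 T, W ((r, q.2), q.1)) Y y * g y := by
  have hi : Integrable (fun p => W p * ((starRingEnd ℂ) (Y p.1.2) * g p.2)) (rayMeasure n T) :=
    hW.integrable_mul (memLp_direction_mul Y hg)
  rw [integral_rayMeasure hi]
  refine integral_congr_ae (.of_forall fun y => ?_)
  simp only [sphereCoeff]
  rw [← integral_mul_const]
  refine integral_congr_ae (.of_forall fun θ => ?_)
  simp only [integral_mul_const]
  ring

theorem memLp_lightRaySlab {u : ℝ × E n → ℂ} (hu : MemLp u 2 (volume.restrict (slab n T))) :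
    MemLp (lightRaySlab T u) 2 (cylMeasure n) := by
  have h := memLp_integral_ray (memLp_ray_shear hu)
  exact h.ae_eq (.of_forall fun p => (lightRaySlab_apply u p.1 p.2).symm)

/-- Modulation of a compactly supported Schwartz function translates its Fourier transform. -/
theorem exists_fourier_translate (h : 𝓢(E n, ℂ)) (hc : HasCompactSupport h) (a : E n) :
    ∃ k : 𝓢(E n, ℂ), (∀ ξ, k ξ =
        Complex.exp (Complex.I * ((2 * Real.pi * inner ℝ ξ a : ℝ) : ℂ)) * h ξ) ∧
      ∀ x, 𝓕 k x = 𝓕 h (x - a) := by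
  have hs : ContDiff ℝ ∞ (fun ξ =>
      Complex.exp (Complex.I * ((2 * Real.pi * inner ℝ ξ a : ℝ) : ℂ)) * h ξ) := by
    refine ContDiff.mul ?_ (h.smooth ⊤)
    exact ContDiff.cexp (contDiff_const.mul (Complex.ofRealCLM.contDiff.comp
      (contDiff_const.mul (contDiff_id.inner ℝ contDiff_const))))
  have hc' : HasCompactSupport (fun ξ =>
      Complex.exp (Complex.I * ((2 * Real.pi * inner ℝ ξ a : ℝ) : ℂ)) * h ξ) := hc.mul_left
  refine ⟨hc'.toSchwartzMap hs, fun ξ => rfl, fun x => ?_⟩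
  rw [SchwartzMap.fourier_coe, SchwartzMap.fourier_coe, Real.fourier_eq', Real.fourier_eq']
  refine integral_congr_ae (.of_forall fun ξ => ?_)
  simp only [HasCompactSupport.toSchwartzMap_toFun, smul_eq_mul]
  rw [← mul_assoc, ← Complex.exp_add, inner_sub_right]
  congr 2
  push_cast
  ring

end

/-! ### The Fourier transform of the light ray transform -/

section

variable {n : ℕ} {T : ℝ}

theorem integral_translate_mul_fourier {f : E n → ℂ} (hf : MemLp f 2 volume) (h : 𝓢(E n, ℂ))
    (hc : HasCompactSupport h) (a : E n) :
    ∫ y, f (y + a) * 𝓕 h y = ∫ ξ, l2Fourier f ξ *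
      (Complex.exp (Complex.I * ((2 * Real.pi * inner ℝ ξ a : ℝ) : ℂ)) * h ξ) := by
  obtain ⟨k, hk, hk'⟩ := exists_fourier_translate h hc a
  have e := integral_l2Fourier_mul hf k
  simp only [hk, hk'] at e
  rw [e, ← integral_add_right_eq_self (fun x => f x * 𝓕 h (x - a)) a]
  simp only [add_sub_cancel_right]

/-- The Fourier transform in `y` of `(r, θ, y) ↦ u(r, y + rθ)`, `u` being the wave with Cauchy data
`f₁, f₂`. -/
noncomputable def raySymbol (f₁ f₂ : E n → ℂ) (p : (ℝ × S n) × E n) : ℂ :=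
  waveSymbol f₁ f₂ p.1.1 p.2 *
    Complex.exp (Complex.I * ((2 * Real.pi * inner ℝ p.2 (p.1.1 • (p.1.2 : E n)) : ℝ) : ℂ))

theorem memLp_raySymbol (f₁ f₂ : E n → ℂ) (T : ℝ) :
    MemLp (raySymbol f₁ f₂) 2 (rayMeasure n T) := by
  have h := memLp_ray (memLp_waveSymbol_slab f₁ f₂ T)
  have hc : Continuous (fun p : (ℝ × S n) × E n =>
      Complex.exp (Complex.I * ((2 * Real.pi * inner ℝ p.2 (p.1.1 • (p.1.2 : E n)) : ℝ) : ℂ))) :=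
    by fun_prop
  refine h.of_le (h.1.mul hc.aestronglyMeasurable) (.of_forall fun p => ?_)
  rw [raySymbol, norm_mul, mul_comm Complex.I, Complex.norm_exp_ofReal_mul_I, mul_one]

theorem integral_raySymbol (f₁ f₂ : E n → ℂ) (ξ : E n) (θ : S n) :
    ∫ r in Ioo 0 T, raySymbol f₁ f₂ ((r, θ), ξ) = rayIntegral T (freq ξ) (l2Fourier f₁ ξ)
      (l2Fourier f₂ ξ) (inner ℝ (‖ξ‖⁻¹ • ξ) (θ : E n)) := by
  rw [rayIntegral]
  refine integral_congr_ae (.of_forall fun r => ?_)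
  simp only [raySymbol, waveSymbol]
  congr 4
  -- At `ξ = 0` the normalised direction takes the default value `0`, which is harmless because both
  -- phases vanish there.
  rcases eq_or_ne ξ 0 with rfl | hξ
  · simp [freq]
  · rw [inner_smul_left, inner_smul_right, freq]
    have : ‖ξ‖ ≠ 0 := norm_ne_zero_iff.2 hξ
    simp only [map_inv₀, conj_trivial]
    field_simp

/-- The Fourier transform in `y` of the light ray transform. -/
noncomputable def lightRaySymbol (T : ℝ) (f₁ f₂ : E n → ℂ) (p : E n × S n) : ℂ :=
  rayIntegral T (freq p.1) (l2Fourier f₁ p.1) (l2Fourier f₂ p.1)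
    (inner ℝ (‖p.1‖⁻¹ • p.1) (p.2 : E n))

theorem memLp_lightRaySymbol (T : ℝ) (f₁ f₂ : E n → ℂ) :
    MemLp (lightRaySymbol T f₁ f₂) 2 (cylMeasure n) := by
  refine (memLp_integral_ray (memLp_raySymbol f₁ f₂ T)).ae_eq (.of_forall fun p => ?_)
  exact integral_raySymbol f₁ f₂ p.1 p.2

/-- A Fourier slice identity, tested against `h`: after Fubini, for fixed `(r, θ)` the translation
by `rθ` turns into a phase on the transform of the slice at time `r`. -/
theorem IsSpectralSolution.l2Fourier_sphereCoeff {f₁ f₂ : E n → ℂ} {u : ℝ × E n → ℂ}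
    (hu : IsSpectralSolution T f₁ f₂ u) (Y : Lp ℂ 2 (sphereMeasure n)) :
    l2Fourier (sphereCoeff (lightRaySlab T u) Y) =ᵐ[volume]
      sphereCoeff (lightRaySymbol T f₁ f₂) Y := by
  have hL := memLp_sphereCoeff (memLp_lightRaySlab hu.memLp) Y
  have hR := memLp_sphereCoeff (memLp_lightRaySymbol T f₁ f₂) Y
  refine ae_eq_of_integral_mul_schwartz (memLp_l2Fourier _) hR fun h hc => ?_
  have hW := memLp_ray_shear hu.memLp
  have hΨ := memLp_raySymbol f₁ f₂ T
  have hh : MemLp h 2 volume := h.memLp 2 volume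
  have hFh : MemLp (𝓕 h : 𝓢(E n, ℂ)) 2 volume := (𝓕 h).memLp 2 volume
  have e1 := integral_ray_mul hW Y hFh
  have e2 := integral_ray_mul hΨ Y hh
  have eL : (fun q : E n × S n => ∫ r in Ioo 0 T, u (r, q.1 + r • (q.2 : E n)))
      = lightRaySlab T u := funext fun q => (lightRaySlab_apply u q.1 q.2).symm
  have eR : (fun q : E n × S n => ∫ r in Ioo 0 T, raySymbol f₁ f₂ ((r, q.2), q.1))
      = lightRaySymbol T f₁ f₂ := funext fun q => integral_raySymbol f₁ f₂ q.1 q.2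
  simp only [eL] at e1
  rw [eR] at e2
  rw [integral_l2Fourier_mul hL, ← e2, ← e1]
  have i1 : Integrable (fun p : (ℝ × S n) × E n => u (p.1.1, p.2 + p.1.1 • (p.1.2 : E n)) *
      ((starRingEnd ℂ) (Y p.1.2) * 𝓕 h p.2)) (rayMeasure n T) :=
    hW.integrable_mul (memLp_direction_mul Y hFh)
  have i2 : Integrable (fun p : (ℝ × S n) × E n => raySymbol f₁ f₂ p *
      ((starRingEnd ℂ) (Y p.1.2) * h p.2)) (rayMeasure n T) :=
    hΨ.integrable_mul (memLp_direction_mul Y hh)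
  rw [integral_prod _ i1, integral_prod _ i2]
  refine integral_congr_ae ?_
  filter_upwards [Measure.quasiMeasurePreserving_fst.ae hu.slice] with q hq
  have e := integral_translate_mul_fourier hq.1 h hc (q.1 • (q.2 : E n))
  have e' : ∫ ξ, l2Fourier (fun x => u (q.1, x)) ξ * (Complex.exp (Complex.I *
      ((2 * Real.pi * inner ℝ ξ (q.1 • (q.2 : E n)) : ℝ) : ℂ)) * h ξ) =
      ∫ ξ, raySymbol f₁ f₂ (q, ξ) * h ξ := by
    refine integral_congr_ae ?_
    filter_upwards [hq.2] with ξ hξ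
    rw [hξ, raySymbol]
    exact (mul_assoc _ _ _).symm
  simp only [mul_left_comm _ ((starRingEnd ℂ) (Y q.2)), integral_const_mul]
  rw [e, e']

end

/-! ### Parseval on the cylinder, and control of low frequencies -/

section

variable {n : ℕ} {T : ℝ}

theorem eLpNorm_two_sq {α : Type*} [MeasurableSpace α] (μ : Measure α) (f : α → ℂ) :
    eLpNorm f 2 μ ^ 2 = ∫⁻ a, ‖f a‖ₑ ^ 2 ∂μ := by
  have h := eLpNorm_nnreal_pow_eq_lintegral (f := f) (μ := μ) (p := 2) two_ne_zero
  simpa using h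

theorem tsum_sphereCoeff {F : E n × S n → ℂ} (hF : MemLp F 2 (cylMeasure n)) :
    ∀ᵐ y, ∑' ℓ : ℕ, ∑ j : Fin (Module.finrank ℂ (sphericalHarmonics n ℓ)),
      ‖sphereCoeff F (stdOrthonormalBasis ℂ (sphericalHarmonics n ℓ) j) y‖ₑ ^ 2
      = ∫⁻ θ, ‖F (y, θ)‖ₑ ^ 2 ∂(sphereMeasure n) := by
  have hsq := (memLp_two_iff_integrable_sq_norm hF.1).1 hF
  filter_upwards [hF.1.prodMk_left, hsq.prod_right_ae] with y h1 h2
  have hy : MemLp (fun θ => F (y, θ)) 2 (sphereMeasure n) :=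
    (memLp_two_iff_integrable_sq_norm h1).2 h2
  have e : ∀ Y : Lp ℂ 2 (sphereMeasure n), sphereCoeff F Y y = inner ℂ Y (hy.toLp _) := by
    intro Y
    rw [L2.inner_def]
    refine integral_congr_ae ?_
    filter_upwards [hy.coeFn_toLp] with θ hθ
    rw [hθ]
    simp
  simp only [e]
  rw [tsum_sphericalHarmonics, Lp.enorm_toLp, eLpNorm_two_sq]

/-- The eigenvalues `ℓ(ℓ + n - 2)` are nonnegative and are dropped from the weight. It then no
longer depends on `ℓ`, and Parseval on almost every sphere collapses the sum. -/
theorem IsSpectralSolution.lintegral_lightRaySymbol_le (hn : 2 ≤ n) {k : ℝ} (hk : 0 ≤ k)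
    {f₁ f₂ : E n → ℂ} {u : ℝ × E n → ℂ} (hu : IsSpectralSolution T f₁ f₂ u) :
    (∫⁻ ξ, ENNReal.ofReal ((1 + freq ξ ^ 2) ^ k) *
      ∫⁻ θ, ‖lightRaySymbol T f₁ f₂ (ξ, θ)‖ₑ ^ 2 ∂(sphereMeasure n)) ^ (1 / 2 : ℝ)
      ≤ cylSobolevENorm k (lightRaySlab T u) := by
  rw [cylSobolevENorm, if_pos (memLp_lightRaySlab hu.memLp)]
  gcongr
  have hw : Measurable fun ξ : E n => ENNReal.ofReal ((1 + freq ξ ^ 2) ^ k) := by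
    have := (continuous_freq (n := n)).measurable
    fun_prop
  have hm : ∀ Y : Lp ℂ 2 (sphereMeasure n), AEMeasurable (fun ξ =>
      ENNReal.ofReal ((1 + freq ξ ^ 2) ^ k) *
        ‖l2Fourier (sphereCoeff (lightRaySlab T u) Y) ξ‖ₑ ^ 2) volume := fun Y =>
    hw.aemeasurable.mul ((memLp_l2Fourier _).1.enorm.pow_const 2)
  have e : ∀ᵐ ξ, ENNReal.ofReal ((1 + freq ξ ^ 2) ^ k) *
      ∫⁻ θ, ‖lightRaySymbol T f₁ f₂ (ξ, θ)‖ₑ ^ 2 ∂(sphereMeasure n) =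
      ∑' ℓ : ℕ, ∑ j : Fin (Module.finrank ℂ (sphericalHarmonics n ℓ)),
        ENNReal.ofReal ((1 + freq ξ ^ 2) ^ k) * ‖l2Fourier (sphereCoeff (lightRaySlab T u)
          (stdOrthonormalBasis ℂ (sphericalHarmonics n ℓ) j)) ξ‖ₑ ^ 2 := by
    have h2 : ∀ᵐ ξ, ∀ (ℓ : ℕ) (j : Fin (Module.finrank ℂ (sphericalHarmonics n ℓ))),
        l2Fourier (sphereCoeff (lightRaySlab T u)
          (stdOrthonormalBasis ℂ (sphericalHarmonics n ℓ) j)) ξ =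
        sphereCoeff (lightRaySymbol T f₁ f₂)
          (stdOrthonormalBasis ℂ (sphericalHarmonics n ℓ) j) ξ :=
      ae_all_iff.2 fun ℓ => ae_all_iff.2 fun j => hu.l2Fourier_sphereCoeff _
    filter_upwards [h2, tsum_sphereCoeff (memLp_lightRaySymbol T f₁ f₂)] with ξ h3 h4
    simp only [h3, ← Finset.mul_sum]
    rw [ENNReal.tsum_mul_left, h4]
  rw [lintegral_congr_ae e, lintegral_tsum fun ℓ =>
    Finset.aemeasurable_fun_sum _ fun j _ => hm _]
  refine ENNReal.tsum_le_tsum fun ℓ => ?_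
  rw [lintegral_finsetSum' _ fun j _ => hm _]
  refine Finset.sum_le_sum fun j _ => lintegral_mono fun ξ => mul_le_mul_left ?_ _
  have h5 : (2 : ℝ) ≤ n := by exact_mod_cast hn
  have h6 : (0 : ℝ) ≤ ℓ * (ℓ + n - 2) := mul_nonneg ℓ.cast_nonneg (by linarith [ℓ.cast_nonneg (α := ℝ)])
  have h7 : 1 + freq ξ ^ 2 ≤ 1 + (2 * Real.pi * ‖ξ‖) ^ 2 + ℓ * (ℓ + n - 2) := by
    rw [freq]
    linarith
  exact ENNReal.ofReal_le_ofReal (Real.rpow_le_rpow (by positivity) h7 hk)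

theorem l2Fourier_ae_eq_fourier {f : E n → ℂ} (hf : MemLp f 2 volume) (hi : Integrable f) :
    l2Fourier f =ᵐ[volume] 𝓕 f := by
  have hcont : Continuous (𝓕 f) :=
    VectorFourier.fourierIntegral_continuous Real.continuous_fourierChar
      (by exact continuous_inner) hi
  refine ae_eq_of_integral_contDiff_smul_eq ((memLp_l2Fourier f).locallyIntegrable
    (by norm_num)) hcont.locallyIntegrable fun g hg hgc => ?_
  have hgC : HasCompactSupport (fun x => (g x : ℂ)) := hgc.comp_left Complex.ofReal_zero
  let h : 𝓢(E n, ℂ) := hgC.toSchwartzMap (Complex.ofRealCLM.contDiff.comp hg)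
  have hh : ∀ x, h x = (g x : ℂ) := fun x => rfl
  have e1 := integral_l2Fourier_mul hf h
  have e2 := VectorFourier.integral_fourierIntegral_smul_eq_flip (L := innerₗ (E n))
    Real.continuous_fourierChar (by exact continuous_inner) hi (h.integrable (μ := volume))
  rw [flip_innerₗ] at e2
  have e3 : ∫ ξ, 𝓕 f ξ * h ξ = ∫ x, f x * 𝓕 h x := e2
  simp only [Complex.real_smul, ← hh, mul_comm (h _)]
  rw [e1, e3]

/-- The transform is bounded by the `L¹` norm, and Cauchy–Schwarz on `V` bounds that by the `L²`
norm. -/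
theorem enorm_l2Fourier_le {V : Set (E n)} (hV : MeasurableSet V) (hVt : volume V ≠ ⊤)
    {f : E n → ℂ} (hf : MemLp f 2 volume) (hs : ∀ᵐ x, x ∉ V → f x = 0) :
    ∀ᵐ ξ, ‖l2Fourier f ξ‖ₑ ^ 2 ≤ volume V * ∫⁻ x, ‖f x‖ₑ ^ 2 := by
  have hfV : eLpNorm f 1 volume = eLpNorm f 1 (volume.restrict V) := by
    rw [← eLpNorm_indicator_eq_eLpNorm_restrict hV]
    refine eLpNorm_congr_ae ?_
    filter_upwards [hs] with x hx
    by_cases h : x ∈ V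
    · simp [h]
    · simp [h, hx h]
  have h1 : eLpNorm f 1 volume ≤ eLpNorm f 2 volume * volume V ^ (1 / 2 : ℝ) := by
    rw [hfV]
    refine (eLpNorm_le_eLpNorm_mul_rpow_measure_univ one_le_two hf.1.restrict).trans ?_
    rw [Measure.restrict_apply_univ,
      show 1 / (1 : ℝ≥0∞).toReal - 1 / (2 : ℝ≥0∞).toReal = 1 / 2 by norm_num]
    gcongr
    exact Measure.restrict_le_self
  have hi : Integrable f := memLp_one_iff_integrable.1 ⟨hf.1, h1.trans_lt
    (ENNReal.mul_lt_top hf.2 (ENNReal.rpow_lt_top_of_nonneg (by norm_num) hVt))⟩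
  filter_upwards [l2Fourier_ae_eq_fourier hf hi] with ξ hξ
  have h2 : ‖l2Fourier f ξ‖ₑ ≤ eLpNorm f 1 volume := by
    rw [hξ, ← ofReal_norm, eLpNorm_one_eq_lintegral_enorm, ← ofReal_integral_norm_eq_lintegral_enorm hi]
    exact ENNReal.ofReal_le_ofReal (VectorFourier.norm_fourierIntegral_le_integral_norm ..)
  calc ‖l2Fourier f ξ‖ₑ ^ 2 ≤ (eLpNorm f 2 volume * volume V ^ (1 / 2 : ℝ)) ^ 2 := by
        gcongr
        exact h2.trans h1
    _ = _ := by
        rw [mul_pow, eLpNorm_two_sq, ← ENNReal.rpow_mul_natCast, mul_comm]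
        norm_num

/-- The Fourier transform of a function supported in a fixed compact set is controlled by its high
frequencies. -/
theorem exists_lintegral_l2Fourier_le (hn : 1 ≤ n) {V : Set (E n)} (hV : IsCompact V) :
    ∃ ε : ℝ, 0 < ε ∧ ∀ k : ℝ, 0 ≤ k → ∀ f : E n → ℂ, MemLp f 2 volume →
      (∀ᵐ x, x ∉ V → f x = 0) →
      ∫⁻ ξ, ENNReal.ofReal ((1 + freq ξ ^ 2) ^ k) * ‖l2Fourier f ξ‖ₑ ^ 2 ≤
        2 * ∫⁻ ξ in {ξ | ε ≤ freq ξ},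
          ENNReal.ofReal ((1 + freq ξ ^ 2) ^ k) * ‖l2Fourier f ξ‖ₑ ^ 2 := by
  have : Nonempty (Fin n) := ⟨⟨0, hn⟩⟩
  have hVt : volume V ≠ ⊤ := hV.measure_lt_top.ne
  -- On a set of this measure the pointwise bound leaves at most half of the `L²` mass. The `+ 1`
  -- keeps the threshold finite when `V` is null.
  obtain ⟨U, hU0, hUo, hU⟩ := Set.exists_isOpen_lt_of_lt (μ := (volume : Measure (E n))) {0}
    (2 * (volume V + 1))⁻¹ (by
      rw [measure_singleton]
      exact ENNReal.inv_pos.2 (ENNReal.mul_ne_top (by simp) (by simp [hVt])))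
  obtain ⟨r, hr, hrU⟩ := Metric.isOpen_iff.1 hUo 0 (hU0 rfl)
  have hε : 0 < 2 * Real.pi * r := by positivity
  refine ⟨2 * Real.pi * r, hε, fun k hk f hf hs => ?_⟩
  set A : Set (E n) := {ξ | 2 * Real.pi * r ≤ freq ξ}
  have hA : MeasurableSet A := measurableSet_le measurable_const continuous_freq.measurable
  have hAc : volume Aᶜ ≤ (2 * (volume V + 1))⁻¹ := by
    refine (measure_mono fun ξ hξ => hrU ?_).trans hU.le
    have h1 : 2 * Real.pi * ‖ξ‖ < 2 * Real.pi * r := not_le.1 hξ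
    rw [mem_ball_zero_iff]
    exact lt_of_mul_lt_mul_left h1 (by positivity)
  have htot : ∫⁻ ξ, ‖l2Fourier f ξ‖ₑ ^ 2 = ∫⁻ x, ‖f x‖ₑ ^ 2 := by
    rw [← eLpNorm_two_sq, ← eLpNorm_two_sq, eLpNorm_l2Fourier hf]
  have hfin : ∫⁻ x, ‖f x‖ₑ ^ 2 ≠ ⊤ := by
    rw [← eLpNorm_two_sq]
    exact ENNReal.pow_ne_top hf.2.ne
  have hlow : 2 * ∫⁻ ξ in Aᶜ, ‖l2Fourier f ξ‖ₑ ^ 2 ≤ ∫⁻ x, ‖f x‖ₑ ^ 2 := by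
    calc 2 * ∫⁻ ξ in Aᶜ, ‖l2Fourier f ξ‖ₑ ^ 2
        ≤ 2 * ∫⁻ ξ in Aᶜ, volume V * ∫⁻ x, ‖f x‖ₑ ^ 2 := by
          gcongr 2 * ?_
          exact lintegral_mono_ae (ae_restrict_of_ae
            (enorm_l2Fourier_le hV.measurableSet hVt hf hs))
      _ = 2 * (volume V * (∫⁻ x, ‖f x‖ₑ ^ 2) * volume Aᶜ) := by
          rw [lintegral_const, Measure.restrict_apply_univ]
      _ ≤ 2 * ((volume V + 1) * (∫⁻ x, ‖f x‖ₑ ^ 2) * (2 * (volume V + 1))⁻¹) := by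
          gcongr
          exact le_self_add
      _ = (2 * (volume V + 1)) * (2 * (volume V + 1))⁻¹ * ∫⁻ x, ‖f x‖ₑ ^ 2 := by ring
      _ = ∫⁻ x, ‖f x‖ₑ ^ 2 := by
          rw [ENNReal.mul_inv_cancel (by simp) (ENNReal.mul_ne_top (by simp) (by simp [hVt])),
            one_mul]
  have hle : ∫⁻ ξ in Aᶜ, ‖l2Fourier f ξ‖ₑ ^ 2 ≤ ∫⁻ ξ in A, ‖l2Fourier f ξ‖ₑ ^ 2 := by
    rw [← htot] at hlow hfin
    have h2 : ∫⁻ ξ in Aᶜ, ‖l2Fourier f ξ‖ₑ ^ 2 ≠ ⊤ :=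
      ne_top_of_le_ne_top hfin (setLIntegral_le_lintegral _ _)
    rw [← lintegral_add_compl (μ := volume) (fun ξ => ‖l2Fourier f ξ‖ₑ ^ 2) hA, two_mul] at hlow
    exact ENNReal.le_of_add_le_add_right h2 hlow
  rw [← lintegral_add_compl _ hA, two_mul]
  refine add_le_add le_rfl ?_
  -- As `k ≥ 0`, the weight is at most its value at `‖ξ‖ = r` on low frequencies and at least that
  -- value on high ones. The unweighted comparison thus transfers to every `k` with the same `ε`.
  calc ∫⁻ ξ in Aᶜ, ENNReal.ofReal ((1 + freq ξ ^ 2) ^ k) * ‖l2Fourier f ξ‖ₑ ^ 2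
      ≤ ∫⁻ ξ in Aᶜ, ENNReal.ofReal ((1 + (2 * Real.pi * r) ^ 2) ^ k) * ‖l2Fourier f ξ‖ₑ ^ 2 := by
        refine setLIntegral_mono_ae' hA.compl (.of_forall fun ξ hξ => ?_)
        have h0 := freq_nonneg ξ
        have h1 : freq ξ ≤ 2 * Real.pi * r := (not_le.1 (show ¬2 * Real.pi * r ≤ freq ξ from hξ)).le
        gcongr
    _ = ENNReal.ofReal ((1 + (2 * Real.pi * r) ^ 2) ^ k) * ∫⁻ ξ in Aᶜ, ‖l2Fourier f ξ‖ₑ ^ 2 :=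
        lintegral_const_mul' _ _ ENNReal.ofReal_ne_top
    _ ≤ ENNReal.ofReal ((1 + (2 * Real.pi * r) ^ 2) ^ k) * ∫⁻ ξ in A, ‖l2Fourier f ξ‖ₑ ^ 2 := by
        gcongr
    _ = ∫⁻ ξ in A, ENNReal.ofReal ((1 + (2 * Real.pi * r) ^ 2) ^ k) * ‖l2Fourier f ξ‖ₑ ^ 2 :=
        (lintegral_const_mul' _ _ ENNReal.ofReal_ne_top).symm
    _ ≤ _ := by
        refine setLIntegral_mono_ae' hA (.of_forall fun ξ hξ => ?_)
        have h1 : 2 * Real.pi * r ≤ freq ξ := hξ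
        gcongr

end

/-! ### Stability and uniqueness -/

section

variable {n : ℕ} {T : ℝ}

/-- The pointwise bound is multiplied by `(1 + q)^s`; the factor `c` is untouched, so the final
constant does not depend on `s`. -/
theorem ofReal_rpow_mul_le {q s c m : ℝ} (hq : 0 ≤ q) (hc : 0 ≤ c) (a b : ℂ) {I : ℝ≥0∞}
    (h : ENNReal.ofReal (c * ((1 + q) * ‖a‖ ^ 2 + ‖b‖ ^ 2)) ≤ ENNReal.ofReal ((1 + q) ^ m) * I) :
    ENNReal.ofReal c * (ENNReal.ofReal ((1 + q) ^ (s + 1)) * ‖a‖ₑ ^ 2 +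
      ENNReal.ofReal ((1 + q) ^ s) * ‖b‖ₑ ^ 2) ≤ ENNReal.ofReal ((1 + q) ^ (s + m)) * I := by
  have hq1 : 0 < 1 + q := by linarith
  rw [Real.rpow_add hq1 s m, ENNReal.ofReal_mul (by positivity), mul_assoc]
  refine le_trans (le_of_eq ?_) (mul_le_mul_right h _)
  rw [← ofReal_norm, ← ofReal_norm, ← ENNReal.ofReal_pow (norm_nonneg _),
    ← ENNReal.ofReal_pow (norm_nonneg _), ← ENNReal.ofReal_mul (by positivity),
    ← ENNReal.ofReal_mul (by positivity), ← ENNReal.ofReal_add (by positivity) (by positivity),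
    ← ENNReal.ofReal_mul hc, ← ENNReal.ofReal_mul (by positivity), Real.rpow_add hq1, Real.rpow_one]
  congr 1
  ring

/-- Stable recovery of the Cauchy data from the light ray transform. -/
theorem exists_sobolevENorm_le (hn : 3 ≤ n) (hT : 0 < T) {V : Set (E n)} (hV : IsCompact V) :
    ∃ C : ℝ, 0 < C ∧ ∀ s : ℝ, 0 ≤ s → ∀ (f₁ f₂ : E n → ℂ) (u : ℝ × E n → ℂ),
      IsSpectralSolution T f₁ f₂ u → (∀ᵐ x, x ∉ V → f₁ x = 0) → (∀ᵐ x, x ∉ V → f₂ x = 0) →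
      sobolevENorm (s + 1) f₁ + sobolevENorm s f₂ ≤
        ENNReal.ofReal C * cylSobolevENorm (s + (n : ℝ) / 2) (lightRaySlab T u) := by
  obtain ⟨ε, hε, hlow⟩ := exists_lintegral_l2Fourier_le (by omega) hV
  obtain ⟨c, hc, hhigh⟩ := exists_le_lintegral_rayIntegral hn hT hε
  -- The outer 2 comes from adding two norms, the inner 2 from absorbing low frequencies into high
  -- ones.
  refine ⟨2 * (2 / c) ^ (1 / 2 : ℝ), by positivity, fun s hs f₁ f₂ u hu hs₁ hs₂ => ?_⟩
  have hP := hu.lintegral_lightRaySymbol_le (k := s + (n : ℝ) / 2) (by omega) (by positivity)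
  set Q := ∫⁻ ξ, ENNReal.ofReal ((1 + freq ξ ^ 2) ^ (s + (n : ℝ) / 2)) *
      ∫⁻ θ, ‖lightRaySymbol T f₁ f₂ (ξ, θ)‖ₑ ^ 2 ∂(sphereMeasure n)
  have hA : MeasurableSet {ξ : E n | ε ≤ freq ξ} :=
    measurableSet_le measurable_const continuous_freq.measurable
  have hpt : ∀ ξ ∈ {ξ : E n | ε ≤ freq ξ}, ENNReal.ofReal c *
      (ENNReal.ofReal ((1 + freq ξ ^ 2) ^ (s + 1)) * ‖l2Fourier f₁ ξ‖ₑ ^ 2 +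
        ENNReal.ofReal ((1 + freq ξ ^ 2) ^ s) * ‖l2Fourier f₂ ξ‖ₑ ^ 2) ≤
      ENNReal.ofReal ((1 + freq ξ ^ 2) ^ (s + (n : ℝ) / 2)) *
        ∫⁻ θ, ‖lightRaySymbol T f₁ f₂ (ξ, θ)‖ₑ ^ 2 ∂(sphereMeasure n) := fun ξ hξ =>
    ofReal_rpow_mul_le (sq_nonneg _) hc.le _ _ (hhigh ξ hξ _ _)
  have hbound : ∀ {k : ℝ} {f : E n → ℂ}, 0 ≤ k → MemLp f 2 volume →
      (∀ᵐ x, x ∉ V → f x = 0) →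
      (∀ ξ ∈ {ξ : E n | ε ≤ freq ξ}, ENNReal.ofReal c *
        (ENNReal.ofReal ((1 + freq ξ ^ 2) ^ k) * ‖l2Fourier f ξ‖ₑ ^ 2) ≤
        ENNReal.ofReal ((1 + freq ξ ^ 2) ^ (s + (n : ℝ) / 2)) *
          ∫⁻ θ, ‖lightRaySymbol T f₁ f₂ (ξ, θ)‖ₑ ^ 2 ∂(sphereMeasure n)) →
      sobolevENorm k f ≤ ENNReal.ofReal ((2 / c) ^ (1 / 2 : ℝ)) *
        cylSobolevENorm (s + (n : ℝ) / 2) (lightRaySlab T u) := by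
    intro k f hk hf hsupp hle
    have h1 : ENNReal.ofReal c * ∫⁻ ξ in {ξ | ε ≤ freq ξ},
        ENNReal.ofReal ((1 + freq ξ ^ 2) ^ k) * ‖l2Fourier f ξ‖ₑ ^ 2 ≤ Q := by
      rw [← lintegral_const_mul' _ _ ENNReal.ofReal_ne_top]
      exact (setLIntegral_mono_ae' hA (.of_forall hle)).trans (setLIntegral_le_lintegral _ _)
    have h2 : ∫⁻ ξ in {ξ | ε ≤ freq ξ},
        ENNReal.ofReal ((1 + freq ξ ^ 2) ^ k) * ‖l2Fourier f ξ‖ₑ ^ 2 ≤ (ENNReal.ofReal c)⁻¹ * Q := by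
      rw [mul_comm, ← div_eq_mul_inv, ENNReal.le_div_iff_mul_le
        (.inl (ENNReal.ofReal_pos.2 hc).ne') (.inl ENNReal.ofReal_ne_top), mul_comm]
      exact h1
    rw [sobolevENorm, if_pos hf]
    calc _ ≤ (2 * ((ENNReal.ofReal c)⁻¹ * Q)) ^ (1 / 2 : ℝ) := by
          gcongr
          exact (hlow k hk f hf hsupp).trans (mul_le_mul_right h2 _)
      _ = ENNReal.ofReal ((2 / c) ^ (1 / 2 : ℝ)) * Q ^ (1 / 2 : ℝ) := by
          rw [← mul_assoc, ENNReal.mul_rpow_of_nonneg _ _ (by norm_num),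
            ← ENNReal.ofReal_rpow_of_pos (by positivity), ENNReal.ofReal_div_of_pos hc,
            ENNReal.ofReal_ofNat, div_eq_mul_inv 2 (ENNReal.ofReal c)]
      _ ≤ _ := by gcongr
  rw [ENNReal.ofReal_mul (by norm_num), ENNReal.ofReal_ofNat, mul_assoc, two_mul]
  refine add_le_add (hbound (by linarith) hu.memLp₁ hs₁ fun ξ hξ => ?_)
    (hbound hs hu.memLp₂ hs₂ fun ξ hξ => ?_)
  · exact (mul_le_mul_right le_self_add _).trans (hpt ξ hξ)
  · exact (mul_le_mul_right le_add_self _).trans (hpt ξ hξ)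

theorem IsCauchyData.memLp {s : ℝ} {V : Set (E n)} {f₁ f₂ : E n → ℂ}
    (h : IsCauchyData s V f₁ f₂) : MemLp f₁ 2 volume ∧ MemLp f₂ 2 volume := by
  constructor
  · by_contra hf
    have := h.sobolev₁
    simp [sobolevENorm, hf] at this
  · by_contra hf
    have := h.sobolev₂
    simp [sobolevENorm, hf] at this

theorem l2Fourier_ae_eq_zero_of_sobolevENorm {k : ℝ} {f : E n → ℂ}
    (h : sobolevENorm k f = 0) : l2Fourier f =ᵐ[volume] 0 := by
  by_cases hf : MemLp f 2 volume
  · rw [sobolevENorm, if_pos hf, ENNReal.rpow_eq_zero_iff_of_pos (by norm_num),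
      lintegral_eq_zero_iff'] at h
    · filter_upwards [h] with ξ hξ
      have h1 : 0 < (1 + (2 * Real.pi * ‖ξ‖) ^ 2) ^ k := by positivity
      simpa [(ENNReal.ofReal_pos.2 h1).ne'] using hξ
    · exact (Measurable.aemeasurable (by fun_prop)).mul ((memLp_l2Fourier f).1.enorm.pow_const 2)
  · simp [sobolevENorm, hf] at h

theorem cylSobolevENorm_eq_zero {F : E n × S n → ℂ} (hF : F =ᵐ[cylMeasure n] 0) (k : ℝ) :
    cylSobolevENorm k F = 0 := by
  have hF0 : MemLp F 2 (cylMeasure n) := (memLp_congr_ae hF).2 MemLp.zero'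
  have hc : ∀ Y : Lp ℂ 2 (sphereMeasure n), l2Fourier (sphereCoeff F Y) =ᵐ[volume] 0 := by
    intro Y
    have h0 : sphereCoeff F Y =ᵐ[volume] 0 := by
      filter_upwards [Measure.ae_ae_of_ae_prod hF] with y hy
      refine integral_eq_zero_of_ae ?_
      filter_upwards [hy] with θ hθ
      simp [hθ]
    rw [← eLpNorm_eq_zero_iff (memLp_l2Fourier _).1 two_ne_zero,
      eLpNorm_l2Fourier (memLp_sphereCoeff hF0 Y), eLpNorm_congr_ae h0, eLpNorm_zero]
  rw [cylSobolevENorm, if_pos hF0, ENNReal.rpow_eq_zero_iff_of_pos (by norm_num),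
    ENNReal.tsum_eq_zero]
  refine fun ℓ => Finset.sum_eq_zero fun j _ => ?_
  refine (lintegral_congr_ae ?_).trans lintegral_zero
  filter_upwards [hc (stdOrthonormalBasis ℂ (sphericalHarmonics n ℓ) j)] with ξ hξ
  simp [hξ]

theorem ae_integrable_ray {u : ℝ × E n → ℂ} (hu : MemLp u 2 (volume.restrict (slab n T))) :
    ∀ᵐ p ∂(cylMeasure n), Integrable (fun r => u (r, p.1 + r • (p.2 : E n)))
      ((volume : Measure ℝ).restrict (Ioo 0 T)) := by
  have h := (memLp_ray_shear hu).comp_measurePreserving (measurePreserving_rayParameter n T)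
  have hsq := (memLp_two_iff_integrable_sq_norm h.1).1 h
  filter_upwards [h.1.prodMk_left, hsq.prod_right_ae] with p h1 h2
  exact ((memLp_two_iff_integrable_sq_norm h1).2 h2).integrable one_le_two

/-- The Bochner integral is additive only where both integrands are integrable, which holds on
almost every ray; hence equality almost everywhere. -/
theorem lightRaySlab_sub {u v : ℝ × E n → ℂ} (hu : MemLp u 2 (volume.restrict (slab n T)))
    (hv : MemLp v 2 (volume.restrict (slab n T))) :
    lightRaySlab T (u - v) =ᵐ[cylMeasure n] lightRaySlab T u - lightRaySlab T v := by
  filter_upwards [ae_integrable_ray hu, ae_integrable_ray hv] with p h1 h2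
  obtain ⟨y, θ⟩ := p
  rw [Pi.sub_apply, lightRaySlab_apply, lightRaySlab_apply, lightRaySlab_apply,
    ← integral_sub h1 h2]
  rfl

end

end LightRay

theorem theorem2p1 (n : ℕ) (hn : 3 ≤ n) (hodd : Odd n) (T : ℝ) (hT : 0 < T)
    (V : Set (LightRay.E n)) (hV : IsCompact V) :
    (∀ s : ℝ, 0 ≤ s → ∀ (f₁ f₂ g₁ g₂ : LightRay.E n → ℂ) (u v : ℝ × LightRay.E n → ℂ),
      LightRay.IsCauchyData s V f₁ f₂ → LightRay.IsCauchyData s V g₁ g₂ →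
      LightRay.IsCauchySolution T f₁ f₂ u → LightRay.IsCauchySolution T g₁ g₂ v →
      LightRay.lightRaySlab T u =ᵐ[LightRay.cylMeasure n] LightRay.lightRaySlab T v →
      u =ᵐ[volume.restrict (LightRay.slab n T)] v ∧ f₁ =ᵐ[volume] g₁ ∧ f₂ =ᵐ[volume] g₂) ∧
    ∃ C : ℝ, 0 < C ∧ ∀ s : ℝ, 0 ≤ s → ∀ (f₁ f₂ : LightRay.E n → ℂ) (u : ℝ × LightRay.E n → ℂ),
      LightRay.IsCauchyData s V f₁ f₂ → LightRay.IsCauchySolution T f₁ f₂ u →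
      LightRay.sobolevENorm (s + 1) f₁ + LightRay.sobolevENorm s f₂ ≤
        ENNReal.ofReal C *
          LightRay.cylSobolevENorm (s + (n : ℝ) / 2) (LightRay.lightRaySlab T u) := by
  obtain ⟨C, hC, hest⟩ := LightRay.exists_sobolevENorm_le hn hT hV
  refine ⟨fun s _ f₁ f₂ g₁ g₂ u v hf hg hu hv huv => ?_, C, hC, fun s hs f₁ f₂ u hf hu =>
    hest s hs f₁ f₂ u (hu.isSpectralSolution hT hf.memLp.1 hf.memLp.2) hf.supp₁ hf.supp₂⟩
  have hw := (hu.isSpectralSolution hT hf.memLp.1 hf.memLp.2).sub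
    (hv.isSpectralSolution hT hg.memLp.1 hg.memLp.2)
  have hL : LightRay.lightRaySlab T (u - v) =ᵐ[LightRay.cylMeasure n] 0 := by
    filter_upwards [LightRay.lightRaySlab_sub hu.memLp hv.memLp, huv] with p h1 h2
    rw [h1, Pi.sub_apply, h2, sub_self, Pi.zero_apply]
  -- The estimate asks only for square-integrable data, so `s = 0` suffices and no Sobolev norm of
  -- the difference is needed.
  have h0 := hest 0 le_rfl (f₁ - g₁) (f₂ - g₂) (u - v) hw
    (by
      filter_upwards [hf.supp₁, hg.supp₁] with x h1 h2 hx
      rw [Pi.sub_apply, h1 hx, h2 hx, sub_self])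
    (by
      filter_upwards [hf.supp₂, hg.supp₂] with x h1 h2 hx
      rw [Pi.sub_apply, h1 hx, h2 hx, sub_self])
  rw [LightRay.cylSobolevENorm_eq_zero hL, mul_zero, nonpos_iff_eq_zero, add_eq_zero] at h0
  have hF₁ := LightRay.l2Fourier_ae_eq_zero_of_sobolevENorm h0.1
  have hF₂ := LightRay.l2Fourier_ae_eq_zero_of_sobolevENorm h0.2
  refine ⟨?_, ?_, ?_⟩
  · filter_upwards [hw.ae_eq_zero hF₁ hF₂] with z hz
    exact sub_eq_zero.1 hz
  · filter_upwards [LightRay.l2Fourier_ae_eq_zero hw.memLp₁ hF₁] with x hx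
    exact sub_eq_zero.1 hx
  · filter_upwards [LightRay.l2Fourier_ae_eq_zero hw.memLp₂ hF₂] with x hx
    exact sub_eq_zero.1 hx
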